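/- Let $k$ be a field with algebraic closure $\bar k$, let $G$ be a smooth affine algebraic $k$-group (not necessarily connected) and let $V$ be a simple $G$-module. For a finite-dimensional $G$-module $M$, define the socle series by $\mathrm{Soc}^0M=0$ and $\mathrm{Soc}^{i+1}M/\mathrm{Soc}^iM=$ the sum of the simple submodules of $M/\mathrm{Soc}^iM$, and the radical series by $\mathrm{Rad}^0M=M$ and $\mathrm{Rad}^{i+1}M=$ the intersection of the maximal submodules of $\mathrm{Rad}^iM$ (zero if $\mathrm{Rad}^iM=0$). Call $M$ rigid if every indecomposable direct summand $U$ of $M$ satisfies $\mathrm{Soc}^iU=\mathrm{Rad}^{\ell-i}U$ for all $0\le i\le\ell$, where $\ell$ is the Loewy length of $U$ (the least $\ell$ with $\mathrm{Soc}^\ell U=U$); call $M$ geometrically rigid if the $G_{\bar k}$-module $M_{\bar k}=M\otimes_k\bar k$ is rigid, and absolutely rigid if the $G_E$-module $M_E=M\otimes_kE$ is rigid for every field extension $E/k$. Then the Jacobson radical $\mathcal J$ of $\mathrm{End}_G(V)\otimes_k\bar k$ has a minimal field of definition $k_V$, that is, a smallest intermediate field $k\subseteq k_V\subseteq\bar k$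 such that $\mathcal J$ is the $\bar k$-span of a left ideal of $\mathrm{End}_G(V)\otimes_kk_V$; the extension $k_V/k$ is finite and purely inseparable; and the $G_{k_V}$-module $V_{k_V}$ is absolutely rigid, i.e. $(V_{k_V})_E$ is rigid for every field extension $E/k_V$. In particular, $V$ is geometrically rigid. -/

import Mathlib

open scoped TensorProduct

universe u v w x

/-- A (left) module for the affine group scheme `G` over `k` with coordinate Hopf algebra
`A = k[G]`, on the `k`-vector space `V`: a right coaction `V → V ⊗ k[G]`.  An element
`g ∈ G(R) = Hom(k[G], R)` acts on `V ⊗ R` by the `R`-linear extension of `(id ⊗ g) ∘ coact`. -/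
structure GModule (k A V : Type*) [CommRing k] [CommRing A] [HopfAlgebra k A]
    [AddCommGroup V] [Module k V] where
  /-- the coaction -/
  coact : V →ₗ[k] V ⊗[k] A
  coassoc : (TensorProduct.assoc k V A A).toLinearMap ∘ₗ coact.rTensor A ∘ₗ coact =
    (Coalgebra.comul (R := k) (A := A)).lTensor V ∘ₗ coact
  counit : (TensorProduct.rid k V).toLinearMap ∘ₗ
    (Coalgebra.counit (R := k) (A := A)).lTensor V ∘ₗ coact = LinearMap.id

namespace GModule

section General

variable {k A V : Type*} [Field k] [CommRing A] [HopfAlgebra k A] [AddCommGroup V] [Module k V]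

/-- `W` is a `G`-submodule: the coaction maps `W` into `W ⊗ k[G] ⊆ V ⊗ k[G]`. -/
def IsSub (M : GModule k A V) (W : Submodule k V) : Prop :=
  ∀ w ∈ W, M.coact w ∈ LinearMap.range (W.subtype.rTensor A)

/-- `L ⊆ N` are `G`-submodules such that the `G`-module `N / L` is simple: it is nonzero, and there
is no `G`-submodule strictly between `L` and `N`. -/
def IsSimpleQuot (M : GModule k A V) (L N : Submodule k V) : Prop :=
  M.IsSub L ∧ M.IsSub N ∧ L < N ∧ ∀ P, M.IsSub P → L ≤ P → P ≤ N → P = L ∨ P = N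

/-- The `G`-module `V` is simple. -/
def IsSimple (M : GModule k A V) : Prop := M.IsSimpleQuot ⊥ ⊤

/-- The algebra `End_G(V)` of `G`-equivariant `k`-linear endomorphisms of `V`. -/
def endAlgebra (M : GModule k A V) : Subalgebra k (Module.End k V) where
  carrier := {f | M.coact ∘ₗ f = f.rTensor A ∘ₗ M.coact}
  mul_mem' {f g} hf hg := by
    simp only [Set.mem_ofPred_eq] at hf hg ⊢
    rw [Module.End.mul_eq_comp, ← LinearMap.comp_assoc, hf, LinearMap.comp_assoc, hg,
      LinearMap.rTensor_comp, LinearMap.comp_assoc]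
  add_mem' {f g} hf hg := by
    simp only [Set.mem_ofPred_eq] at hf hg ⊢
    rw [LinearMap.comp_add, hf, hg, LinearMap.rTensor_add, LinearMap.add_comp]
  algebraMap_mem' c := by
    ext v
    rw [Algebra.algebraMap_eq_smul_one, LinearMap.rTensor_smul, Module.End.one_eq_id,
      LinearMap.rTensor_id]
    simp

/-- The socle series of the `G`-submodule `U` of `V`: `Soc⁰ U = 0`, and `Socⁱ⁺¹ U` is the preimage
in `U` of the sum of the simple submodules of `U / Socⁱ U`, that is, the sum of `Socⁱ U` and of all
`G`-submodules `N` with `Socⁱ U ⊆ N ⊆ U` for which `N / Socⁱ U` is simple. -/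
def socleSeries (M : GModule k A V) (U : Submodule k V) : ℕ → Submodule k V
  | 0 => ⊥
  | i + 1 => socleSeries M U i ⊔ sSup {N | N ≤ U ∧ M.IsSimpleQuot (socleSeries M U i) N}

/-- The radical series of the `G`-submodule `U` of `V`: `Rad⁰ U = U`, and `Radⁱ⁺¹ U` is the
intersection of the maximal `G`-submodules of `Radⁱ U` (it is `Radⁱ U` if there are none). -/
def radicalSeries (M : GModule k A V) (U : Submodule k V) : ℕ → Submodule k V
  | 0 => U
  | i + 1 => radicalSeries M U i ⊓ sInf {N | M.IsSimpleQuot N (radicalSeries M U i)}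

/-- `U` is an indecomposable direct summand of the `G`-module `V`. -/
def IsIndecomposableSummand (M : GModule k A V) (U : Submodule k V) : Prop :=
  M.IsSub U ∧ (∃ W, M.IsSub W ∧ IsCompl U W) ∧ U ≠ ⊥ ∧
    ∀ U₁ U₂, M.IsSub U₁ → M.IsSub U₂ → Disjoint U₁ U₂ → U₁ ⊔ U₂ = U → U₁ = ⊥ ∨ U₂ = ⊥

/-- The `G`-module `V` is rigid: each indecomposable summand `U` has a Loewy length `ℓ`, and
`Socⁱ U = Radˡ⁻ⁱ U` with `l = ℓ`, for all `0 ≤ i ≤ ℓ`. -/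
def IsRigid (M : GModule k A V) : Prop :=
  ∀ U, M.IsIndecomposableSummand U →
    ∃ ℓ : ℕ, IsLeast {n | M.socleSeries U n = U} ℓ ∧
      ∀ i ≤ ℓ, M.socleSeries U i = M.radicalSeries U (ℓ - i)

end General

section BaseChange

variable {k A V : Type*} [Field k] [CommRing A] [HopfAlgebra k A] [AddCommGroup V] [Module k V]

/-- The coaction of `V_E`: the `E`-linear extension of the coaction of `V`, followed by
`E ⊗ (V ⊗ k[G]) ≃ (E ⊗ V) ⊗_E (E ⊗ k[G])`. -/
noncomputable def baseChangeCoact (E : Type*) [Field E] [Algebra k E] (M : GModule k A V) :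
    E ⊗[k] V →ₗ[E] (E ⊗[k] V) ⊗[E] (E ⊗[k] A) :=
  (TensorProduct.AlgebraTensorModule.distribBaseChange k E V A).toLinearMap ∘ₗ
    M.coact.baseChange E

theorem baseChangeCoact_tmul (E : Type*) [Field E] [Algebra k E] (M : GModule k A V)
    (e : E) (v : V) : baseChangeCoact E M (e ⊗ₜ v) =
      TensorProduct.AlgebraTensorModule.distribBaseChange k E V A (e ⊗ₜ M.coact v) := rfl

/-- `E ⊗ (V ⊗ (A ⊗ A)) → E ⊗ V ⊗_E (E ⊗ A ⊗_E E ⊗ A)`. -/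
noncomputable def baseChangeThree (k A V E : Type*) [Field k] [CommRing A] [HopfAlgebra k A]
    [AddCommGroup V] [Module k V] [Field E] [Algebra k E] :
    E ⊗[k] (V ⊗[k] (A ⊗[k] A)) →ₗ[E] (E ⊗[k] V) ⊗[E] ((E ⊗[k] A) ⊗[E] (E ⊗[k] A)) :=
  (TensorProduct.AlgebraTensorModule.distribBaseChange k E A A).toLinearMap.lTensor (E ⊗[k] V) ∘ₗ
    (TensorProduct.AlgebraTensorModule.distribBaseChange k E V (A ⊗[k] A)).toLinearMap

theorem baseChange_assoc_rTensor (E : Type*) [Field E] [Algebra k E] (M : GModule k A V)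
    (e : E) (t : V ⊗[k] A) :
    TensorProduct.assoc E (E ⊗[k] V) (E ⊗[k] A) (E ⊗[k] A)
      ((baseChangeCoact E M).rTensor (E ⊗[k] A)
        (TensorProduct.AlgebraTensorModule.distribBaseChange k E V A (e ⊗ₜ t))) =
    baseChangeThree k A V E (e ⊗ₜ TensorProduct.assoc k V A A (M.coact.rTensor A t)) := by
  induction t with
  | zero => simp only [TensorProduct.tmul_zero, map_zero]
  | add s t hs ht => simp only [TensorProduct.tmul_add, map_add, hs, ht]
  | tmul v a =>
    rw [TensorProduct.AlgebraTensorModule.distribBaseChange_tmul, LinearMap.rTensor_tmul,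
      LinearMap.rTensor_tmul, baseChangeCoact_tmul]
    induction M.coact v with
    | zero => simp only [TensorProduct.tmul_zero, TensorProduct.zero_tmul, map_zero]
    | add s t hs ht =>
      simp only [TensorProduct.tmul_add, TensorProduct.add_tmul, map_add, hs, ht]
    | tmul w b => rfl

theorem baseChange_lTensor_comul (E : Type*) [Field E] [Algebra k E] (e : E) (t : V ⊗[k] A) :
    baseChangeThree k A V E (e ⊗ₜ (Coalgebra.comul (R := k) (A := A)).lTensor V t) =
      (Coalgebra.comul (R := E) (A := E ⊗[k] A)).lTensor (E ⊗[k] V)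
        (TensorProduct.AlgebraTensorModule.distribBaseChange k E V A (e ⊗ₜ t)) := by
  induction t with
  | zero => simp only [TensorProduct.tmul_zero, map_zero]
  | add s t hs ht => simp only [TensorProduct.tmul_add, map_add, hs, ht]
  | tmul v a =>
    rw [TensorProduct.AlgebraTensorModule.distribBaseChange_tmul, LinearMap.lTensor_tmul,
      LinearMap.lTensor_tmul, TensorProduct.comul_tmul]
    induction Coalgebra.comul (R := k) a with
    | zero => simp only [TensorProduct.tmul_zero, map_zero]
    | add s t hs ht => simp only [TensorProduct.tmul_add, map_add, hs, ht]
    | tmul b c => rfl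

theorem baseChange_rid_lTensor_counit (E : Type*) [Field E] [Algebra k E] (e : E)
    (t : V ⊗[k] A) :
    TensorProduct.rid E (E ⊗[k] V) ((Coalgebra.counit (R := E) (A := E ⊗[k] A)).lTensor (E ⊗[k] V)
        (TensorProduct.AlgebraTensorModule.distribBaseChange k E V A (e ⊗ₜ t))) =
      e ⊗ₜ TensorProduct.rid k V ((Coalgebra.counit (R := k) (A := A)).lTensor V t) := by
  induction t with
  | zero => simp only [TensorProduct.tmul_zero, map_zero]
  | add s t hs ht => simp only [TensorProduct.tmul_add, map_add, hs, ht]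
  | tmul v a =>
    rw [TensorProduct.AlgebraTensorModule.distribBaseChange_tmul, LinearMap.lTensor_tmul,
      LinearMap.lTensor_tmul, TensorProduct.rid_tmul, TensorProduct.rid_tmul,
      TensorProduct.counit_tmul, TensorProduct.tmul_smul]
    simp

/-- The base change `V_E = E ⊗ V`, a module for the base change `G_E`, whose coordinate Hopf
algebra over `E` is `E ⊗ k[G]`. -/
noncomputable def baseChange (E : Type*) [Field E] [Algebra k E] (M : GModule k A V) :
    GModule E (E ⊗[k] A) (E ⊗[k] V) where
  coact := baseChangeCoact E M
  coassoc := by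
    refine TensorProduct.AlgebraTensorModule.ext fun e v => ?_
    have h := LinearMap.congr_fun M.coassoc v
    simp only [LinearMap.comp_apply, LinearEquiv.coe_coe] at h ⊢
    simp only [baseChangeCoact_tmul]
    have h₁ := baseChange_assoc_rTensor E M e (M.coact v)
    rw [h] at h₁
    rw [h₁, baseChange_lTensor_comul]
  counit := by
    refine TensorProduct.AlgebraTensorModule.ext fun e v => ?_
    have h := LinearMap.congr_fun M.counit v
    simp only [LinearMap.comp_apply, LinearEquiv.coe_coe, LinearMap.id_apply] at h ⊢
    rw [baseChangeCoact_tmul, baseChange_rid_lTensor_counit, h]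

/-- The `G`-module `V` is geometrically rigid: it is rigid over the algebraic closure. -/
def IsGeometricallyRigid (M : GModule k A V) : Prop :=
  (M.baseChange (AlgebraicClosure k)).IsRigid

end BaseChange

/-- The `G`-module `V` is absolutely rigid: `V_E` is rigid for every field extension `E` of `k`
(the universe `y` of `E` is arbitrary). -/
def IsAbsolutelyRigid.{y, u', v', w'} {k : Type u'} {A : Type v'} {V : Type w'} [Field k]
    [CommRing A] [HopfAlgebra k A] [AddCommGroup V] [Module k V] (M : GModule k A V) : Prop :=
  ∀ (E : Type y) [Field E] [Algebra k E], (M.baseChange E).IsRigid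

end GModule

/-- For a `k`-algebra `D` and a field extension `K / k`, the intermediate field `F` is a field of
definition of the left ideal `J` of `D_K = K ⊗ D`: there is a left ideal `N` of `D_F = F ⊗ D` such
that `N_K = J` inside `D_K`, i.e. `J` is the `K`-span of the image of `N`. -/
def IsFieldOfDefinition {k K D : Type*} [Field k] [Field K] [Algebra k K] [Ring D] [Algebra k D]
    (J : Ideal (K ⊗[k] D)) (F : IntermediateField k K) : Prop :=
  ∃ N : Ideal (F ⊗[k] D),
    Submodule.span K
      ((Algebra.TensorProduct.map F.val (AlgHom.id k D) : F ⊗[k] D → K ⊗[k] D) ''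
        (N : Set (F ⊗[k] D))) =
      J.restrictScalars K

/-- `F` is the minimal field of definition of the left ideal `J` of `D_K`: it is a field of
definition, and it is contained in every field of definition. -/
def IsMinimalFieldOfDefinition {k K D : Type*} [Field k] [Field K] [Algebra k K] [Ring D]
    [Algebra k D] (J : Ideal (K ⊗[k] D)) (F : IntermediateField k K) : Prop :=
  IsLeast {F' | IsFieldOfDefinition J F'} F

/-! Let `B` be the algebra of operators on V generated by the coefficients of the coaction, and D =
End_G(V) its centraliser. V is a faithful simple `B`-module, so `B` is simple, D is a division
algebra, and they share a centre Z, a finite field extension of k (`exists_common_center`). For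
every E/k the G_E-submodules of V_E are its E ⊗ B-submodules. The radicals of E ⊗ B and of E ⊗ D are
both generated by the nilradical n of E ⊗ Z (`jacobson_tensorProduct_eq_map`). With J = rad(E ⊗ B),
socle layers are the elements killed by powers of J, and radical layers are J^i V_E. As V is free
over Z, rigidity of V_E follows from Ann(n^i) = n^(ℓ-i) in E ⊗ Z, which is `HasRigidNilradical`
(`isRigid_of_torsion_le`, `GModule.isRigid_baseChange`).

The field-theoretic heart is that K ⊗ Z has this property for K algebraically closed
(`hasRigidNilradical_tensorProduct`). The separable closure of k in Z stays reduced over K. Above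
it, Z is built by steps L(x)/L of degree p^j in which x^(p^j) lies in the field generated by the
p^j-th powers of L (`exists_adjoin_simple_eq_top_and_pow_mem`). Over K this power has a p^j-th root
g in K ⊗ L, so y = x - g satisfies y^(p^j) = 0 and the step becomes the truncated polynomial ring (K
⊗ L)[y]/(y^(p^j)); such rings inherit the property (`HasRigidNilradical.of_truncatedPolynomial`).

For the field of definition, choose basis vectors of D that give a basis modulo the radical. The
coefficients expressing the others are unique, so they generate the smallest field of definition.
Automorphisms of the algebraic closure preserve the radical, hence fix the coefficients, whence pure
inseparability. Over this field k_V the nilradical of k_V ⊗ Z generates that of K ⊗ Z, and therefore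
that of E ⊗ Z for every E/k_V. Powers and annihilators are compatible with such an extension, so the
property descends from K to k_V and ascends to E. -/

section

/-! ### Rigid nilradicals and truncated polynomial rings. -/

open Polynomial

/-- For some `ℓ` the nilradical `n` of `R` satisfies `n ^ ℓ = 0`, and the annihilator of `n ^ i` is
contained in (and so equal to) `n ^ (ℓ - i)` for all `i ≤ ℓ`. -/
def HasRigidNilradical (R : Type*) [CommRing R] : Prop :=
  ∃ ℓ : ℕ, nilradical R ^ ℓ = ⊥ ∧ ∀ i ≤ ℓ, ∀ t : R,
    (∀ s ∈ nilradical R ^ i, s * t = 0) → t ∈ nilradical R ^ (ℓ - i)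

/-- Here R is A[X]/(X^q), whose nilradical is generated by that of A and by X. Its powers are
therefore graded by the degree in X, each factor X saving one nilpotent of A. -/
theorem mem_nilradical_pow_iff_coeff {A R : Type*} [CommRing A] [CommRing R] {q : ℕ} (hq : 0 < q)
    (ψ : A[X] →+* R) (hψ : Function.Surjective ψ)
    (hker : ∀ P, ψ P = 0 ↔ ∀ m < q, P.coeff m = 0) (i : ℕ) (P : A[X]) :
    ψ P ∈ nilradical R ^ i ↔ ∀ m < q, P.coeff m ∈ nilradical A ^ (i - m) := by
  have hX : ψ X ∈ nilradical R := by
    rw [mem_nilradical]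
    refine ⟨q, ?_⟩
    rw [← map_pow, hker]
    intro m hm
    rw [coeff_X_pow, if_neg (by omega)]
  have hC : ∀ a ∈ nilradical A, ψ (C a) ∈ nilradical R := fun a ha => by
    rw [mem_nilradical] at ha ⊢
    exact (ha.map C).map ψ
  have hC' : ∀ j, ∀ a ∈ nilradical A ^ j, ψ (C a) ∈ nilradical R ^ j := fun j a ha => by
    have h1 : (nilradical A).map (ψ.comp C) ≤ nilradical R := Ideal.map_le_iff_le_comap.2 hC
    have h2 := Ideal.mem_map_of_mem (ψ.comp C) ha
    rw [Ideal.map_pow] at h2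
    exact Ideal.pow_right_mono h1 j h2
  have h0 : ∀ P, ψ P ∈ nilradical R → P.coeff 0 ∈ nilradical A := by
    intro P hP
    have h1 : ψ (C (P.coeff 0)) ∈ nilradical R := by
      have : ψ P = ψ X * ψ P.divX + ψ (C (P.coeff 0)) := by
        conv_lhs => rw [← divX_mul_X_add P]
        rw [map_add, map_mul, mul_comm]
      rw [← sub_eq_iff_eq_add'.2 this]
      exact sub_mem hP (Ideal.mul_mem_right _ _ hX)
    rw [mem_nilradical] at h1 ⊢
    obtain ⟨n, hn⟩ := h1
    rw [← map_pow, ← C_pow, hker] at hn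
    exact ⟨n, by simpa only [← C_pow, coeff_C_zero] using hn 0 hq⟩
  constructor
  · intro h
    induction i generalizing P with
    | zero => intro m _; simp
    | succ i ih =>
      rw [pow_succ'] at h
      -- Quantifying over all lifts `P` lets sums and products be computed on convenient lifts;
      -- `hker` shows that low coefficients do not depend on the lift.
      suffices H : ∀ x ∈ nilradical R * nilradical R ^ i, ∀ P, ψ P = x →
          ∀ m < q, P.coeff m ∈ nilradical A ^ (i + 1 - m) from H _ h P rfl
      intro x hx
      induction hx using Submodule.mul_induction_on' with
      | mem_mul_mem g hg f hf =>
        intro P hP m hm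
        obtain ⟨G, rfl⟩ := hψ g
        obtain ⟨F, rfl⟩ := hψ f
        have hPm : P.coeff m = (G * F).coeff m := by
          rw [← sub_eq_zero, ← coeff_sub]
          exact (hker _).1 (by rw [map_sub, hP, map_mul, sub_self]) m hm
        rw [hPm, coeff_mul]
        refine sum_mem fun c hc => ?_
        rw [Finset.HasAntidiagonal.mem_antidiagonal] at hc
        have hF := ih F hf c.2 (by omega)
        rcases Nat.eq_zero_or_pos c.1 with h | h
        · have := Ideal.mul_mem_mul (h0 G hg) hF
          rw [← pow_succ'] at this
          rw [h]
          exact Ideal.pow_le_pow_right (by omega) this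
        · exact Ideal.mul_mem_left _ _ (Ideal.pow_le_pow_right (by omega) hF)
      | add x _ y _ hx hy =>
        intro P hP m hm
        obtain ⟨Q, rfl⟩ := hψ x
        have := add_mem (hx Q rfl m hm) (hy (P - Q) (by rw [map_sub, hP]; ring) m hm)
        simpa using this
  · intro h
    have : ψ P = ψ (∑ m ∈ Finset.range q, C (P.coeff m) * X ^ m) := by
      rw [← sub_eq_zero, ← map_sub, hker]
      intro m hm
      simp [finsetSum_coeff, coeff_C_mul, coeff_X_pow, hm]
    rw [this, map_sum]
    refine sum_mem fun m hm => ?_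
    rw [Finset.mem_range] at hm
    rw [map_mul, map_pow]
    have := Ideal.mul_mem_mul (hC' _ _ (h m hm)) (Ideal.pow_mem_pow hX m)
    rw [← pow_add] at this
    exact Ideal.pow_le_pow_right (by omega) this

/-- The length grows by q - 1, the last nonzero power of X. Testing an annihilating element against
s X^d isolates one coefficient at a time, which reduces the claim to A. -/
theorem HasRigidNilradical.of_truncatedPolynomial {A R : Type*} [CommRing A] [CommRing R] {q : ℕ}
    (hq : 0 < q) (ψ : A[X] →+* R) (hψ : Function.Surjective ψ)
    (hker : ∀ P, ψ P = 0 ↔ ∀ m < q, P.coeff m = 0) (hA : HasRigidNilradical A) :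
    HasRigidNilradical R := by
  obtain ⟨ℓ, hℓ, hann⟩ := hA
  have key := mem_nilradical_pow_iff_coeff hq ψ hψ hker
  refine ⟨ℓ + (q - 1), ?_, ?_⟩
  · rw [eq_bot_iff]
    intro x hx
    obtain ⟨P, rfl⟩ := hψ x
    rw [key] at hx
    rw [Ideal.mem_bot, hker]
    intro m hm
    have := Ideal.pow_le_pow_right (I := nilradical A) (show ℓ ≤ ℓ + (q - 1) - m by omega) (hx m hm)
    rwa [hℓ] at this
  · intro i _ t ht
    obtain ⟨P, rfl⟩ := hψ t
    rw [key]
    intro m hm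
    -- The largest shift that uses at most i factors X and keeps the degree m + d below q.
    obtain ⟨d, hd⟩ : ∃ d, d = min i (q - 1 - m) := ⟨_, rfl⟩
    have h1 : ∀ s ∈ nilradical A ^ (i - d), s * P.coeff m = 0 := by
      intro s hs
      have h2 : ψ (C s * X ^ d) ∈ nilradical R ^ i := by
        rw [key]
        intro m' _
        rw [coeff_C_mul_X_pow]
        split_ifs with h
        · rwa [h]
        · exact zero_mem _
      have h3 := ht _ h2
      rw [← map_mul, hker] at h3
      have := h3 (m + d) (by omega)
      rwa [mul_assoc, coeff_C_mul, mul_comm (X ^ d), coeff_mul_X_pow] at this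
    by_cases hdi : d = i
    · have := h1 1 (by simp [hdi])
      rw [one_mul] at this
      rw [this]
      exact zero_mem _
    · by_cases hl : i - d ≤ ℓ
      · have := hann _ hl _ h1
        exact Ideal.pow_le_pow_right (by omega) this
      -- The exponent truncates to 0 here, so the condition on the coefficient is empty.
      · rw [show ℓ + (q - 1) - i - m = 0 by omega]
        simp

theorem HasRigidNilradical.of_isReduced {R : Type*} [CommRing R] [IsReduced R] :
    HasRigidNilradical R := by
  refine ⟨1, by rw [pow_one]; exact nilradical_eq_zero R, fun i hi t ht => ?_⟩
  obtain rfl | rfl : i = 0 ∨ i = 1 := by omega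
  · have := ht 1 (by simp)
    rw [one_mul] at this
    rw [this]
    exact zero_mem _
  · simp

end

/-! ### Generators of finite purely inseparable extensions. -/

section

open IntermediateField Polynomial
section
variable {E Z : Type*} [Field E] [Field Z] [Algebra E Z]

theorem finrank_adjoin_simple_of_pow_mem {p : ℕ} [Fact p.Prime] [CharP Z p]
    (H : IntermediateField E Z) {a : Z} (ha : a ^ p ∈ H) (ha' : a ∉ H) :
    Module.finrank H H⟮a⟯ = p := by
  have : CharP H p := (algebraMap H Z).charP (algebraMap H Z).injective p
  have hirr : Irreducible (X ^ p - C (⟨a ^ p, ha⟩ : H)) := by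
    refine X_pow_sub_C_irreducible_of_prime Fact.out fun b hb => ha' ?_
    have h2 : (b : Z) ^ p = a ^ p := by
      have := congrArg (algebraMap H Z) hb
      simpa using this
    have := frobenius_inj Z p (a₁ := (b : Z)) (a₂ := a) (by simpa [frobenius_def] using h2)
    rw [← this]; exact b.2
  have hint : IsIntegral H a := ⟨X ^ p - C (⟨a ^ p, ha⟩ : H),
    monic_X_pow_sub_C _ (Nat.Prime.ne_zero Fact.out), by simp⟩
  rw [adjoin.finrank hint, ← minpoly.eq_of_irreducible_of_monic hirr (by simp)
    (monic_X_pow_sub_C _ (Nat.Prime.ne_zero Fact.out)), natDegree_X_pow_sub_C]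

theorem relfinrank_sup_adjoin_simple (H : IntermediateField E Z) (a : Z) :
    relfinrank H (H ⊔ adjoin E {a}) = Module.finrank H H⟮a⟯ := by
  rw [relfinrank_eq_finrank_of_le le_sup_left]
  have : extendScalars (F := H) (E := H ⊔ adjoin E {a}) le_sup_left = H⟮a⟯ := by
    apply restrictScalars_injective E
    rw [extendScalars_restrictScalars, restrictScalars_adjoin_eq_sup]
  rw [this]

/-- Adjoining the elements one by one, each step has degree 1 or p. If no element is redundant given
all the others, none is redundant given the earlier ones, and every degree is p. -/
theorem relfinrank_sup_adjoin_image {ι : Type*} {p : ℕ} [Fact p.Prime] [CharP Z p]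
    (H : IntermediateField E Z) (f : ι → Z) (T : Finset ι) (hf : ∀ t ∈ T, f t ^ p ∈ H) :
    relfinrank H (H ⊔ adjoin E (f '' T)) ≤ p ^ T.card ∧
    ((∀ t ∈ T, f t ∉ H ⊔ adjoin E (f '' (T \ {t} : Set ι))) →
      relfinrank H (H ⊔ adjoin E (f '' T)) = p ^ T.card) := by
  classical
  have hp : 0 < p := Nat.Prime.pos Fact.out
  induction T using Finset.induction_on with
  | empty => simp [relfinrank_self]
  | insert a T ha ih =>
    obtain ⟨ih1, ih2⟩ := ih fun t ht => hf t (Finset.mem_insert_of_mem ht)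
    have e : H ⊔ adjoin E (f '' (insert a T : Finset ι)) =
        (H ⊔ adjoin E (f '' T)) ⊔ adjoin E {f a} := by
      rw [Finset.coe_insert, Set.image_insert_eq, Set.insert_eq, adjoin_union, sup_assoc,
        sup_comm (adjoin E {f a})]
    have h1 := relfinrank_mul_relfinrank (A := H) (B := H ⊔ adjoin E (f '' T))
      (C := (H ⊔ adjoin E (f '' T)) ⊔ adjoin E {f a}) le_sup_left le_sup_left
    have hap : f a ^ p ∈ H ⊔ adjoin E (f '' T) :=
      (le_sup_left : H ≤ H ⊔ adjoin E (f '' T)) (hf a (Finset.mem_insert_self _ _))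
    rw [relfinrank_sup_adjoin_simple] at h1
    rw [e, ← h1, Finset.card_insert_of_notMem ha, pow_succ]
    constructor
    · refine Nat.mul_le_mul ih1 ?_
      by_cases h : f a ∈ H ⊔ adjoin E (f '' T)
      · rw [← relfinrank_sup_adjoin_simple, relfinrank_eq_one_iff.2
          (sup_le le_rfl (adjoin_simple_le_iff.2 h))]
        exact hp
      · exact (finrank_adjoin_simple_of_pow_mem _ hap h).le
    · intro h
      rw [ih2, finrank_adjoin_simple_of_pow_mem _ hap]
      · have := h a (Finset.mem_insert_self _ _)
        rwa [Finset.coe_insert, Set.insert_sdiff_self_of_notMem (by simpa using ha)] at this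
      · intro t ht h'
        refine h t (Finset.mem_insert_of_mem ht) ?_
        refine (sup_le_sup_left (adjoin.mono E _ _ (Set.image_mono ?_)) H) h'
        exact Set.sdiff_subset_sdiff_left (by simp)

theorem mem_of_mem_adjoin_pow {p : ℕ} [Fact p.Prime] [CharP Z p] [IsPurelyInseparable E Z]
    (H : IntermediateField E Z) {w : Z} (hw : w ∈ H ⊔ adjoin E {w ^ p}) : w ∈ H := by
  have : CharP E p := (algebraMap E Z).charP (algebraMap E Z).injective p
  obtain ⟨r, y, hy⟩ := IsPurelyInseparable.pow_mem E p w
  have hr : w ^ p ^ r ∈ H := by rw [← hy]; exact H.algebraMap_mem y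
  clear hy y
  induction r with
  | zero => simpa using hr
  | succ r ih =>
    apply ih
    -- The field of z with z^(p^r) in H contains H and w^p, hence w; this lowers the exponent r by
    -- one.
    let N : IntermediateField E Z :=
      { (H.toSubfield.comap (iterateFrobenius Z p r)) with
        algebraMap_mem' := fun c => by
          change iterateFrobenius Z p r (algebraMap E Z c) ∈ H
          rw [iterateFrobenius_def, ← map_pow]; exact H.algebraMap_mem _ }
    have hN : ∀ z, z ∈ N ↔ z ^ p ^ r ∈ H := fun z => by
      change iterateFrobenius Z p r z ∈ H ↔ _
      rw [iterateFrobenius_def]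
    rw [← hN]
    refine (sup_le (fun z hz => (hN z).2 (pow_mem hz _)) ?_ : H ⊔ adjoin E {w ^ p} ≤ N) hw
    rw [adjoin_simple_le_iff, hN, ← pow_mul, ← pow_succ']
    exact hr

/-- Take a generating set B of least size, and the least j at which some x in B becomes redundant
among the p^j-th powers. Let L be generated by B without x. Below level j every step for B has full
degree p^|B|, while for B without x it is at most p^(|B|-1). The two towers end in the same field,
so comparing degrees gives [Z : L] ≥ p^j. -/
theorem exists_adjoin_simple_eq_top_and_pow_mem {p : ℕ} [Fact p.Prime] [CharP Z p]
    [FiniteDimensional E Z] [IsPurelyInseparable E Z] (hE : (⊥ : IntermediateField E Z) ≠ ⊤) :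
    ∃ (L : IntermediateField E Z) (x : Z) (j : ℕ), 0 < j ∧ L⟮x⟯ = ⊤ ∧ Module.finrank L Z = p ^ j ∧
      x ^ p ^ j ∈ adjoin E ((fun z => z ^ p ^ j) '' (L : Set Z)) := by
  classical
  have hp : 0 < p := Nat.Prime.pos Fact.out
  have hcE : CharP E p := (algebraMap E Z).charP (algebraMap E Z).injective p
  let G : Set Z → ℕ → IntermediateField E Z := fun T j => adjoin E ((fun z => z ^ p ^ j) '' T)
  have hG : ∀ T j, G T j = adjoin E ((fun z => z ^ p ^ j) '' T) := fun T j => rfl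
  have hG0 : ∀ T, G T 0 = adjoin E T := fun T => by simp [hG]
  have hGmono : ∀ {S T} j, S ⊆ T → G S j ≤ G T j := fun j h =>
    adjoin.mono E _ _ (Set.image_mono h)
  have hGmem : ∀ {T : Set Z} j {t}, t ∈ T → t ^ p ^ j ∈ G T j := fun j t ht =>
    subset_adjoin E _ ⟨t, ht, rfl⟩
  have hGanti : ∀ T j, G T (j + 1) ≤ G T j := fun T j => by
    rw [hG, adjoin_le_iff]
    rintro _ ⟨t, ht, rfl⟩
    simp only [pow_succ, pow_mul]
    exact pow_mem (hGmem j ht) p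
  have hGsup : ∀ T j, G T (j + 1) ⊔ G T j = G T j := fun T j => sup_eq_right.2 (hGanti T j)
  have hex : ∃ n, ∃ B : Finset Z, adjoin E (B : Set Z) = ⊤ ∧ B.card = n := by
    obtain ⟨B, hB⟩ := fg_of_noetherian (⊤ : IntermediateField E Z)
    exact ⟨_, B, hB, rfl⟩
  obtain ⟨B, hB, hBcard⟩ := Nat.find_spec hex
  have hBne : B.Nonempty := by
    rw [Finset.nonempty_iff_ne_empty]
    rintro rfl
    exact hE (by simpa using hB)
  have hexj : ∃ j, ∃ x ∈ B, G (B \ {x} : Set Z) j = G B j := by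
    obtain ⟨x, hx⟩ := hBne
    -- At the exponent of Z/E all the powers lie in E, so every generator is redundant.
    refine ⟨IsPurelyInseparable.exponent E Z, x, hx, ?_⟩
    have : ∀ T : Set Z, G T (IsPurelyInseparable.exponent E Z) = ⊥ := fun T => by
      rw [hG, adjoin_eq_bot_iff]
      rintro _ ⟨t, -, rfl⟩
      have := IsPurelyInseparable.exponent_def' E p t
      exact mem_bot.2 this
    rw [this, this]
  obtain ⟨x, hx, hxj⟩ := Nat.find_spec hexj
  obtain ⟨j, hj⟩ : ∃ j, j = Nat.find hexj := ⟨_, rfl⟩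
  rw [← hj] at hxj
  have hlt : ∀ i < j, ∀ y ∈ B, G (B \ {y} : Set Z) i ≠ G B i := fun i hi y hy h =>
    Nat.find_min hexj (hj ▸ hi) ⟨y, hy, h⟩
  have hBx : ((B.erase x : Finset Z) : Set Z) = (B \ {x} : Set Z) := by simp
  have hins : ∀ y ∈ B, (B : Set Z) = insert y (B \ {y} : Set Z) := fun y hy => by
    rw [Set.insert_sdiff_singleton, Set.insert_eq_of_mem (Finset.mem_coe.2 hy)]
  have hGins : ∀ y ∈ B, ∀ i, G B i = adjoin E {y ^ p ^ i} ⊔ G (B \ {y} : Set Z) i :=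
    fun y hy i => by
      conv_lhs => rw [hins y hy, hG, Set.image_insert_eq, Set.insert_eq, adjoin_union]
  -- Redundancy at level 0 would contradict the minimal size of B.
  have hj0 : 0 < j := by
    rw [Nat.pos_iff_ne_zero]
    rintro rfl
    rw [hG0, hG0, hB] at hxj
    refine Nat.find_min hex (m := (B.erase x).card) ?_ ⟨B.erase x, by rw [hBx, hxj], rfl⟩
    rw [← hBcard]
    exact Finset.card_erase_lt_of_mem hx
  have hrel : ∀ (T : Finset Z) i, relfinrank (G T (i + 1)) (G T i) ≤ p ^ T.card ∧
      ((∀ t ∈ T, t ^ p ^ i ∉ G T (i + 1) ⊔ G (T \ {t} : Set Z) i) →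
      relfinrank (G T (i + 1)) (G T i) = p ^ T.card) := fun T i => by
    have := relfinrank_sup_adjoin_image (p := p) (G T (i + 1)) (fun z => z ^ p ^ i) T
      (fun t ht => by
        rw [← pow_mul, ← pow_succ]
        exact hGmem _ ht)
    simp only [← hG, hGsup] at this
    exact this
  have hBrank : ∀ i < j, relfinrank (G B (i + 1)) (G B i) = p ^ B.card := fun i hi => by
    refine (hrel B i).2 fun t ht h => ?_
    -- Only the p-th power of t^(p^i) is added to the field without t, so `mem_of_mem_adjoin_pow`
    -- makes t redundant at level i, against the choice of j.
    have hle : G B (i + 1) ⊔ G (B \ {t} : Set Z) i ≤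
        G (B \ {t} : Set Z) i ⊔ adjoin E {(t ^ p ^ i) ^ p} := by
      refine sup_le ?_ le_sup_left
      rw [hGins t ht, ← pow_mul, ← pow_succ]
      exact sup_le le_sup_right ((hGanti _ i).trans le_sup_left)
    have hmem := mem_of_mem_adjoin_pow _ (hle h)
    refine hlt i hi t ht (le_antisymm (hGmono i Set.sdiff_subset) ?_)
    rw [hGins t ht]
    exact sup_le (adjoin_simple_le_iff.2 hmem) le_rfl
  have hanti : ∀ T i, G T i ≤ G T 0 := fun T i => by
    induction i with
    | zero => exact le_rfl
    | succ i ih => exact (hGanti T i).trans ih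
  have hBdeg : ∀ i ≤ j, relfinrank (G B i) (G B 0) = p ^ (i * B.card) := fun i => by
    induction i with
    | zero => simp [relfinrank_self]
    | succ i ih =>
      intro hi
      rw [← relfinrank_mul_relfinrank (hGanti B i) (hanti B i), ih (by omega),
        hBrank i (by omega), ← pow_add, Nat.succ_mul, add_comm]
  have hTdeg : ∀ (T : Finset Z) i, relfinrank (G T i) (G T 0) ≤ p ^ (i * T.card) := fun T i => by
    induction i with
    | zero => simp [relfinrank_self]
    | succ i ih =>
      rw [← relfinrank_mul_relfinrank (hGanti T i) (hanti T i), Nat.succ_mul, pow_add, mul_comm (p ^ _)]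
      exact Nat.mul_le_mul (hrel T i).1 ih
  have htop : (adjoin E (B \ {x} : Set Z))⟮x⟯ = ⊤ := by
    apply restrictScalars_injective E
    rw [restrictScalars_adjoin_eq_sup, ← adjoin_union, Set.union_comm, ← Set.insert_eq,
      ← hins x hx, hB, restrictScalars_top]
  have hpow : x ^ p ^ j ∈ G (B \ {x} : Set Z) j := by
    rw [hxj]
    exact hGmem j hx
  have hLmem : x ^ p ^ j ∈ adjoin E (B \ {x} : Set Z) := by
    have := hanti _ _ hpow
    rwa [hG0] at this
  refine ⟨adjoin E (B \ {x} : Set Z), x, j, hj0, htop, le_antisymm ?_ ?_,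
    adjoin.mono E _ _ (Set.image_mono (subset_adjoin E _)) hpow⟩
  · have hmonic := monic_X_pow_sub_C (⟨x ^ p ^ j, hLmem⟩ : adjoin E (B \ {x} : Set Z))
      (pow_pos hp j).ne'
    have hroot : aeval x (X ^ p ^ j - C (⟨x ^ p ^ j, hLmem⟩ : adjoin E (B \ {x} : Set Z))) = 0 := by
      simp
    rw [← finrank_top', ← htop, adjoin.finrank ⟨_, hmonic, hroot⟩]
    refine (natDegree_le_natDegree (minpoly.min _ _ hmonic hroot)).trans ?_
    rw [natDegree_X_pow_sub_C]
  · have h1 := hBdeg j le_rfl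
    rw [hG0, hB, relfinrank_top_right, ← hxj, ← relfinrank_mul_finrank_top (hanti _ j)] at h1
    have h2 := hTdeg (B.erase x) j
    rw [hBx, Finset.card_erase_of_mem hx] at h2
    rw [hG0] at h1 h2
    have h3 : p ^ (j * (B.card - 1)) * p ^ j = p ^ (j * B.card) := by
      rw [← pow_add]
      congr 1
      obtain ⟨c, hc⟩ : ∃ c, B.card = c + 1 := ⟨B.card - 1, by have := Finset.card_pos.2 ⟨x, hx⟩; omega⟩
      rw [hc]
      simp
      ring
    rw [← h3] at h1
    refine Nat.le_of_mul_le_mul_left ?_ (pow_pos hp (j * (B.card - 1)))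
    rw [← h1]
    exact Nat.mul_le_mul_right _ h2

end

end

/-! ### The nilradical of K ⊗ Z for K algebraically closed. -/

section

open IntermediateField Polynomial

/-- The powers of y below q span R over A, and the dimension count makes the resulting surjection
from A^q bijective. Thus R is A[y]/(y^q). -/
theorem HasRigidNilradical.of_adjoin_nilpotent {K A R : Type*} [Field K] [CommRing A] [CommRing R]
    [Algebra K A] [Algebra K R] [FiniteDimensional K A] [FiniteDimensional K R] {q : ℕ}
    (hq : 0 < q) (φ : A →ₐ[K] R) (y : R) (hy : y ^ q = 0)
    (hsurj : Function.Surjective (eval₂RingHom (φ : A →+* R) y))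
    (hrank : Module.finrank K R = q * Module.finrank K A) (hA : HasRigidNilradical A) :
    HasRigidNilradical R := by
  refine HasRigidNilradical.of_truncatedPolynomial hq (eval₂RingHom (φ : A →+* R) y) hsurj ?_ hA
  let Θ : (Fin q → A) →ₗ[K] R :=
    ∑ m : Fin q, (LinearMap.mulRight K (y ^ (m : ℕ))) ∘ₗ φ.toLinearMap ∘ₗ LinearMap.proj m
  have hΘ : ∀ P : A[X], eval₂RingHom (φ : A →+* R) y P = Θ fun m => P.coeff m := by
    intro P
    have h1 : eval₂RingHom (φ : A →+* R) y P =
        ∑ m ∈ Finset.range (q + P.natDegree + 1), φ (P.coeff m) * y ^ m := by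
      rw [coe_eval₂RingHom, eval₂_eq_sum_range' _ (show P.natDegree < q + P.natDegree + 1 by omega)]
      rfl
    have h2 : Θ (fun m => P.coeff m) = ∑ m ∈ Finset.range q, φ (P.coeff m) * y ^ m := by
      rw [Finset.sum_range]
      simp [Θ]
    rw [h1, h2]
    symm
    refine Finset.sum_subset (Finset.range_subset_range.2 (by omega)) fun m _ hm => ?_
    rw [Finset.mem_range, not_lt] at hm
    rw [pow_eq_zero_of_le hm hy, mul_zero]
  have hΘs : Function.Surjective Θ := fun r => by
    obtain ⟨P, rfl⟩ := hsurj r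
    exact ⟨_, (hΘ P).symm⟩
  have hΘi : Function.Injective Θ := by
    refine (LinearMap.injective_iff_surjective_of_finrank_eq_finrank ?_).2 hΘs
    rw [Module.finrank_pi_fintype, hrank]
    simp
  intro P
  rw [hΘ, map_eq_zero_iff _ hΘi, funext_iff]
  exact ⟨fun h m hm => h ⟨m, hm⟩, fun h m => h m m.2⟩

theorem isReduced_tensorProduct_of_isSeparable (k K E : Type*) [Field k] [Field K] [Algebra k K]
    [Field E] [Algebra k E] [FiniteDimensional k E] [Algebra.IsSeparable k E] :
    IsReduced (K ⊗[k] E) := by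
  have := Algebra.FormallyUnramified.of_isSeparable k E
  exact Algebra.FormallyUnramified.isReduced_of_field K (K ⊗[k] E)

/-- The z for which 1 ⊗ z is a p^j-th power coming from K ⊗ L form an E-algebra containing the
p^j-th powers of L. Frobenius gives closure under sums, and scalars of k have roots in K. -/
theorem exists_pow_eq_one_tmul {k K E Z : Type*} [Field k] [Field K] [Algebra k K] [IsAlgClosed K]
    [Field E] [Algebra k E] [Algebra.IsSeparable k E]
    [Field Z] [Algebra k Z] [Algebra E Z] [IsScalarTower k E Z] [FiniteDimensional E Z]
    {p : ℕ} [Fact p.Prime] [CharP k p] (j : ℕ) (L : IntermediateField E Z) {x : Z}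
    (hx : x ∈ adjoin E ((fun z => z ^ p ^ j) '' (L : Set Z))) :
    ∃ g : K ⊗[k] L,
      Algebra.TensorProduct.map (AlgHom.id K K) (L.val.restrictScalars k) g ^ p ^ j = 1 ⊗ₜ x := by
  have : CharP (K ⊗[k] L) p := charP_of_injective_algebraMap (algebraMap k (K ⊗[k] L)).injective p
  set φ := Algebra.TensorProduct.map (AlgHom.id K K) (L.val.restrictScalars k) with hφ
  have hsmul : ∀ (c : k) (g : K ⊗[k] L), ∃ g', g' ^ p ^ j = c • g ^ p ^ j := by
    intro c g
    obtain ⟨d, hd⟩ := IsAlgClosed.exists_pow_nat_eq (algebraMap k K c)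
      (pow_pos (Nat.Prime.pos (Fact.out : p.Prime)) j)
    refine ⟨d • g, ?_⟩
    rw [_root_.smul_pow, hd, algebraMap_smul]
  let S : Subalgebra E Z :=
    { carrier := {z | ∃ g : K ⊗[k] L, φ (g ^ p ^ j) = 1 ⊗ₜ z}
      mul_mem' := by
        rintro a b ⟨g, hg⟩ ⟨h, hh⟩
        exact ⟨g * h, by rw [mul_pow, map_mul, hg, hh, Algebra.TensorProduct.tmul_mul_tmul, one_mul]⟩
      add_mem' := by
        rintro a b ⟨g, hg⟩ ⟨h, hh⟩
        exact ⟨g + h, by rw [add_pow_char_pow, map_add, hg, hh, TensorProduct.tmul_add]⟩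
      algebraMap_mem' := by
        intro e
        -- Separability of E/k: the p^j-th powers of E span E over k.
        have he : e ∈ Submodule.span k (Set.range fun e : E => e ^ p ^ j) := by
          rw [Field.span_map_pow_expChar_pow_eq_top_of_isSeparable p j (F := k) (v := fun e : E => e)
            (by simp [Set.range_id'])]
          trivial
        induction he using Submodule.span_induction with
        | mem e he =>
          obtain ⟨e, rfl⟩ := he
          refine ⟨1 ⊗ₜ algebraMap E L e, ?_⟩
          rw [Algebra.TensorProduct.tmul_pow, one_pow, hφ, Algebra.TensorProduct.map_tmul]
          simp
        | zero => exact ⟨0, by simp [(Nat.Prime.pos (Fact.out : p.Prime)).ne']⟩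
        | add a b _ _ ha hb =>
          obtain ⟨g, hg⟩ := ha
          obtain ⟨h, hh⟩ := hb
          exact ⟨g + h, by rw [add_pow_char_pow, map_add, hg, hh, map_add, TensorProduct.tmul_add]⟩
        | smul c a _ ha =>
          obtain ⟨g, hg⟩ := ha
          obtain ⟨g', hg'⟩ := hsmul c g
          refine ⟨g', ?_⟩
          rw [hg', show φ (c • g ^ p ^ j) = c • φ (g ^ p ^ j) from
            φ.toLinearMap.map_smul_of_tower c _, hg, Algebra.smul_def c a, map_mul,
            ← IsScalarTower.algebraMap_apply, ← Algebra.smul_def, TensorProduct.tmul_smul] }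
  have hS : (adjoin E ((fun z => z ^ p ^ j) '' (L : Set Z))).toSubalgebra ≤ S := by
    rw [adjoin_toSubalgebra_of_isAlgebraic fun z _ => Algebra.IsAlgebraic.isAlgebraic z,
      Algebra.adjoin_le_iff]
    rintro _ ⟨l, hl, rfl⟩
    refine ⟨1 ⊗ₜ ⟨l, hl⟩, ?_⟩
    rw [Algebra.TensorProduct.tmul_pow, one_pow, hφ, Algebra.TensorProduct.map_tmul]
    simp
  obtain ⟨g, hg⟩ := hS hx
  exact ⟨g, by rw [← map_pow, hg]⟩

theorem hasRigidNilradical_of_isPurelyInseparable {k : Type*} (K : Type*) {E : Type*} [Field k]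
    [Field K] [Algebra k K] [IsAlgClosed K] [Field E] [Algebra k E] [FiniteDimensional k E]
    [Algebra.IsSeparable k E] (n : ℕ) :
    ∀ (Z : Type*) [Field Z] [Algebra k Z] [Algebra E Z] [IsScalarTower k E Z]
      [FiniteDimensional E Z] [IsPurelyInseparable E Z], Module.finrank E Z = n →
      HasRigidNilradical (K ⊗[k] Z) := by
  induction n using Nat.strong_induction_on with
  | _ n ih =>
  intro Z _ _ _ _ _ _ hn
  by_cases hE : (⊥ : IntermediateField E Z) = ⊤
  · have hs : Algebra.IsSeparable k Z := by
      have hsur : Function.Surjective (algebraMap E Z) := fun z => by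
        have : z ∈ (⊥ : IntermediateField E Z) := hE ▸ mem_top
        exact mem_bot.1 this
      have : Algebra.IsSeparable E Z := ⟨fun z => by
        obtain ⟨e, rfl⟩ := hsur z
        exact isSeparable_algebraMap e⟩
      exact Algebra.IsSeparable.trans k E Z
    have : FiniteDimensional k Z := FiniteDimensional.trans k E Z
    have := isReduced_tensorProduct_of_isSeparable k K Z
    exact HasRigidNilradical.of_isReduced
  obtain ⟨p, hp⟩ := ExpChar.exists k
  cases hp with
  | zero =>
    refine absurd ?_ hE
    have : CharZero E := charZero_of_injective_algebraMap (algebraMap k E).injective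
    have : Algebra.IsSeparable E Z := inferInstance
    rw [eq_top_iff]
    intro z _
    exact mem_bot.2 (IsPurelyInseparable.surjective_algebraMap_of_isSeparable E Z z)
  | prime hp =>
    have := Fact.mk hp
    have : CharP Z p := charP_of_injective_algebraMap (algebraMap k Z).injective p
    obtain ⟨L, x, j, hj, hLx, hdeg, hx⟩ :=
      exists_adjoin_simple_eq_top_and_pow_mem (p := p) (E := E) (Z := Z) hE
    obtain ⟨g, hg⟩ := exists_pow_eq_one_tmul (k := k) (K := K) j L hx
    have : FiniteDimensional k Z := FiniteDimensional.trans k E Z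
    have : FiniteDimensional k L := FiniteDimensional.trans k E L
    have : CharP (K ⊗[k] Z) p := charP_of_injective_algebraMap (algebraMap k (K ⊗[k] Z)).injective p
    have hq : 1 < p ^ j := Nat.one_lt_pow hj.ne' hp.one_lt
    have htower : Module.finrank E L * p ^ j = Module.finrank E Z := by
      rw [← hdeg, Module.finrank_mul_finrank]
    have hL : HasRigidNilradical (K ⊗[k] L) := by
      refine ih (Module.finrank E L) ?_ L rfl
      have : 0 < Module.finrank E L := Module.finrank_pos
      rw [← hn, ← htower]
      nlinarith
    set φ := Algebra.TensorProduct.map (AlgHom.id K K) (L.val.restrictScalars k) with hφ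
    -- Subtracting the root g makes the generator nilpotent: by Frobenius its p^j-th power is zero.
    refine HasRigidNilradical.of_adjoin_nilpotent (K := K) (q := p ^ j) (by omega) φ
      (1 ⊗ₜ x - φ g) ?_ ?_ ?_ hL
    · rw [sub_pow_char_pow, hg, Algebra.TensorProduct.tmul_pow, one_pow, sub_self]
    · obtain ⟨S, hS⟩ : ∃ S : Subsemiring (K ⊗[k] Z),
          S = (eval₂RingHom (φ : K ⊗[k] L →+* K ⊗[k] Z) (1 ⊗ₜ x - φ g)).rangeS := ⟨_, rfl⟩
      have hy : (1 : K) ⊗ₜ[k] x ∈ S :=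
        hS ▸ ⟨X + C g, by simp⟩
      have hC : ∀ t, φ t ∈ S :=
        fun t => hS ▸ ⟨C t, by simp⟩
      intro t
      rw [← RingHom.mem_rangeS, ← hS]
      induction t with
      | zero => exact zero_mem _
      | add a b ha hb => exact add_mem ha hb
      | tmul c z =>
        have h1 : c ⊗ₜ[k] (1 : Z) ∈ S := by
          have := hC (c ⊗ₜ 1)
          rwa [hφ, Algebra.TensorProduct.map_tmul, map_one] at this
        have h2 : (1 : K) ⊗ₜ[k] z ∈ S := by
          have hz : z ∈ Algebra.adjoin L {x} := by
            rw [← adjoin_simple_toSubalgebra_of_isAlgebraic (Algebra.IsAlgebraic.isAlgebraic x), hLx]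
            trivial
          induction hz using Algebra.adjoin_induction with
          | mem z hz => rwa [Set.mem_singleton_iff.1 hz]
          | algebraMap l =>
            have := hC (1 ⊗ₜ l)
            rwa [hφ, Algebra.TensorProduct.map_tmul, map_one] at this
          | add a b _ _ ha hb => rw [TensorProduct.tmul_add]; exact add_mem ha hb
          | mul a b _ _ ha hb =>
            have := mul_mem ha hb
            rwa [Algebra.TensorProduct.tmul_mul_tmul, one_mul] at this
        have := mul_mem h1 h2
        rwa [Algebra.TensorProduct.tmul_mul_tmul, one_mul, mul_one] at this
    · rw [Module.finrank_baseChange, Module.finrank_baseChange, ← Module.finrank_mul_finrank k E Z,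
        ← htower, ← Module.finrank_mul_finrank k E L]
      ring

theorem hasRigidNilradical_tensorProduct {k : Type*} (K Z : Type*) [Field k] [Field K]
    [Algebra k K] [IsAlgClosed K] [Field Z] [Algebra k Z] [FiniteDimensional k Z] :
    HasRigidNilradical (K ⊗[k] Z) :=
  hasRigidNilradical_of_isPurelyInseparable K (E := separableClosure k Z) _ Z rfl

end

/-! ### Extension of left ideals, tested by linear functionals on the larger field. -/

section ExtendScalars

variable (k : Type*) {E : Type*} (Ω C : Type*) [Field k] [Field E] [Field Ω] [Algebra k E]
  [Algebra k Ω] [Algebra E Ω] [IsScalarTower k E Ω] [Ring C] [Algebra k C]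

/-- The canonical map `E ⊗ C → Ω ⊗ C` for a field extension `Ω / E`. -/
noncomputable def extendScalarsHom : E ⊗[k] C →ₐ[k] Ω ⊗[k] C :=
  Algebra.TensorProduct.map (IsScalarTower.toAlgHom k E Ω) (AlgHom.id k C)

variable {Ω}

/-- The map `Ω ⊗ C → E ⊗ C` induced by an `E`-linear functional on `Ω`. -/
noncomputable def functionalTensor (ρ : Ω →ₗ[E] E) : Ω ⊗[k] C →ₗ[k] E ⊗[k] C :=
  (ρ.restrictScalars k).rTensor C

variable {k C}

@[simp]
theorem extendScalarsHom_tmul (e : E) (c : C) :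
    extendScalarsHom k Ω C (e ⊗ₜ c) = algebraMap E Ω e ⊗ₜ c := by
  simp [extendScalarsHom]

@[simp]
theorem functionalTensor_tmul (ρ : Ω →ₗ[E] E) (a : Ω) (c : C) :
    functionalTensor k C ρ (a ⊗ₜ c) = ρ a ⊗ₜ c := rfl

theorem functionalTensor_mul_extendScalarsHom (ρ : Ω →ₗ[E] E) (t : Ω ⊗[k] C) (s : E ⊗[k] C) :
    functionalTensor k C ρ (t * extendScalarsHom k Ω C s) = functionalTensor k C ρ t * s := by
  induction t with
  | zero => simp
  | add a b ha hb => simp only [add_mul, map_add, ha, hb]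
  | tmul a c =>
    induction s with
    | zero => simp
    | add x y hx hy => simp only [mul_add, map_add, hx, hy]
    | tmul e d =>
      rw [extendScalarsHom_tmul, Algebra.TensorProduct.tmul_mul_tmul, functionalTensor_tmul,
        functionalTensor_tmul, Algebra.TensorProduct.tmul_mul_tmul, mul_comm a, ← Algebra.smul_def,
        map_smul, smul_eq_mul, mul_comm]

theorem functionalTensor_extendScalarsHom (ρ : Ω →ₗ[E] E) (s : E ⊗[k] C) :
    functionalTensor k C ρ (extendScalarsHom k Ω C s) = (ρ 1 ⊗ₜ 1) * s := by
  have := functionalTensor_mul_extendScalarsHom ρ 1 s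
  rwa [one_mul, Algebra.TensorProduct.one_def, functionalTensor_tmul] at this

variable (E Ω) in
theorem exists_functional_one : ∃ ρ : Ω →ₗ[E] E, ρ 1 = 1 := by
  obtain ⟨ρ, hρ⟩ := LinearMap.exists_leftInverse_of_injective (Algebra.linearMap E Ω)
    (LinearMap.ker_eq_bot.2 (algebraMap E Ω).injective)
  exact ⟨ρ, by simpa using LinearMap.congr_fun hρ 1⟩

theorem extendScalarsHom_injective :
    Function.Injective (extendScalarsHom k Ω C : E ⊗[k] C → Ω ⊗[k] C) := by
  obtain ⟨ρ, hρ⟩ := exists_functional_one E Ω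
  refine Function.LeftInverse.injective (g := functionalTensor k C ρ) fun s => ?_
  rw [functionalTensor_extendScalarsHom, hρ, ← Algebra.TensorProduct.one_def, one_mul]

theorem exists_eq_sum_functionalTensor (t : Ω ⊗[k] C) :
    ∃ s : Finset (Module.Basis.ofVectorSpaceIndex E Ω),
      t = ∑ b ∈ s, (Module.Basis.ofVectorSpace E Ω b ⊗ₜ 1) *
        extendScalarsHom k Ω C (functionalTensor k C ((Module.Basis.ofVectorSpace E Ω).coord b) t) := by
  classical
  set B := Module.Basis.ofVectorSpace E Ω
  suffices H : ∃ s, ∀ s', s ⊆ s' → t = ∑ b ∈ s', (B b ⊗ₜ 1) *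
      extendScalarsHom k Ω C (functionalTensor k C (B.coord b) t) by
    obtain ⟨s, hs⟩ := H
    exact ⟨s, hs s subset_rfl⟩
  induction t with
  | zero => exact ⟨∅, fun s' _ => by simp⟩
  | add x y hx hy =>
    obtain ⟨s, hs⟩ := hx
    obtain ⟨s₂, hs₂⟩ := hy
    refine ⟨s ∪ s₂, fun s' h => ?_⟩
    simp only [map_add, mul_add, Finset.sum_add_distrib]
    rw [← hs _ (Finset.union_subset_left h), ← hs₂ _ (Finset.union_subset_right h)]
  | tmul a c =>
    refine ⟨(B.repr a).support, fun s' h => ?_⟩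
    conv_lhs => rw [← B.linearCombination_repr a, Finsupp.linearCombination_apply,
      Finsupp.sum_of_support_subset _ h _ (by simp), TensorProduct.sum_tmul]
    refine Finset.sum_congr rfl fun b _ => ?_
    rw [functionalTensor_tmul, extendScalarsHom_tmul, Algebra.TensorProduct.tmul_mul_tmul, one_mul,
      Module.Basis.coord_apply, Algebra.smul_def, mul_comm]

/-- Functionals give maps that are right linear over E ⊗ C, and an element is recovered from its
coordinates in an E-basis of Ω. This is the tool for all descent below. -/
theorem mem_map_extendScalarsHom_iff {I : Ideal (E ⊗[k] C)} {t : Ω ⊗[k] C} :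
    t ∈ I.map (extendScalarsHom k Ω C) ↔ ∀ ρ : Ω →ₗ[E] E, functionalTensor k C ρ t ∈ I := by
  constructor
  · intro h ρ
    induction h using Submodule.span_induction generalizing ρ with
    | mem x hx =>
      obtain ⟨s, hs, rfl⟩ := hx
      change functionalTensor k C ρ (extendScalarsHom k Ω C s) ∈ I
      rw [functionalTensor_extendScalarsHom]
      exact I.mul_mem_left _ hs
    | zero => rw [map_zero]; exact zero_mem _
    | add x y _ _ hx hy => rw [map_add]; exact add_mem (hx ρ) (hy ρ)
    | smul r x _ hx =>
      obtain ⟨s, hs⟩ := exists_eq_sum_functionalTensor (E := E) x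
      rw [hs, smul_eq_mul, Finset.mul_sum, map_sum]
      refine sum_mem fun b _ => ?_
      rw [← mul_assoc, functionalTensor_mul_extendScalarsHom]
      exact I.mul_mem_left _ (hx _)
  · intro h
    obtain ⟨s, hs⟩ := exists_eq_sum_functionalTensor (E := E) t
    rw [hs]
    exact sum_mem fun b _ => Ideal.mul_mem_left _ _ (Ideal.mem_map_of_mem _ (h _))

theorem extendScalarsHom_mem_map_iff {I : Ideal (E ⊗[k] C)} {s : E ⊗[k] C} :
    extendScalarsHom k Ω C s ∈ I.map (extendScalarsHom k Ω C) ↔ s ∈ I := by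
  refine ⟨fun h => ?_, Ideal.mem_map_of_mem _⟩
  obtain ⟨ρ, hρ⟩ := exists_functional_one E Ω
  have := mem_map_extendScalarsHom_iff.1 h ρ
  rwa [functionalTensor_extendScalarsHom, hρ, ← Algebra.TensorProduct.one_def, one_mul] at this

end ExtendScalars

/-! ### The nilradical under extension of the base field. -/

section Nilradical

variable {k : Type*} (E Ω Z : Type*) [Field k] [Field E] [Field Ω] [Algebra k E]
  [Algebra k Ω] [Algebra E Ω] [IsScalarTower k E Ω] [CommRing Z] [Algebra k Z]

/-- The nilradical of `E ⊗ Z` generates the nilradical of `Ω ⊗ Z`. -/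
def NilradicalExtends : Prop :=
  nilradical (Ω ⊗[k] Z) = (nilradical (E ⊗[k] Z)).map (extendScalarsHom k Ω Z)

variable {E Ω Z}

theorem map_nilradical_le :
    (nilradical (E ⊗[k] Z)).map (extendScalarsHom k Ω Z) ≤ nilradical (Ω ⊗[k] Z) := by
  rw [Ideal.map_le_iff_le_comap]
  intro s hs
  rw [mem_nilradical] at hs
  exact mem_nilradical.2 (hs.map _)

theorem HasRigidNilradical.ascend (h : NilradicalExtends (k := k) E Ω Z)
    (hE : HasRigidNilradical (E ⊗[k] Z)) : HasRigidNilradical (Ω ⊗[k] Z) := by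
  obtain ⟨ℓ, hℓ, hann⟩ := hE
  rw [NilradicalExtends] at h
  refine ⟨ℓ, by rw [h, ← Ideal.map_pow, hℓ, Ideal.map_bot], fun i hi t ht => ?_⟩
  rw [h, ← Ideal.map_pow, mem_map_extendScalarsHom_iff]
  refine fun ρ => hann i hi _ fun s hs => ?_
  rw [mul_comm, ← functionalTensor_mul_extendScalarsHom, mul_comm, ht, map_zero]
  rw [h, ← Ideal.map_pow]
  exact Ideal.mem_map_of_mem _ hs

theorem HasRigidNilradical.descend (h : NilradicalExtends (k := k) E Ω Z)
    (hΩ : HasRigidNilradical (Ω ⊗[k] Z)) : HasRigidNilradical (E ⊗[k] Z) := by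
  obtain ⟨ℓ, hℓ, hann⟩ := hΩ
  rw [NilradicalExtends] at h
  refine ⟨ℓ, ?_, fun i hi t ht => ?_⟩
  · rw [h, ← Ideal.map_pow] at hℓ
    refine (Submodule.eq_bot_iff _).2 fun x hx => ?_
    have := Ideal.mem_map_of_mem (extendScalarsHom k Ω Z) hx
    rw [hℓ, Ideal.mem_bot] at this
    exact (map_eq_zero_iff _ extendScalarsHom_injective).1 this
  · rw [← extendScalarsHom_mem_map_iff (Ω := Ω), Ideal.map_pow, ← h]
    refine hann i hi _ fun s hs => ?_
    rw [h, ← Ideal.map_pow, mem_map_extendScalarsHom_iff] at hs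
    obtain ⟨c, hc⟩ := exists_eq_sum_functionalTensor (E := E) s
    rw [hc, Finset.sum_mul]
    refine Finset.sum_eq_zero fun b _ => ?_
    rw [mul_assoc, ← map_mul, ht _ (hs _), map_zero, mul_zero]

/-- Every prime of E ⊗ Z is the kernel of a character to E, which extends to a character of Ω ⊗ Z.
Functionals commute with these characters, and the latter kill nilpotents. -/
theorem nilradicalExtends_of_isAlgClosed [IsAlgClosed E] [FiniteDimensional k Z] :
    NilradicalExtends (k := k) E Ω Z := by
  refine le_antisymm (fun t ht => ?_) map_nilradical_le
  rw [mem_map_extendScalarsHom_iff]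
  intro ρ
  have : IsArtinianRing (E ⊗[k] Z) := IsArtinianRing.of_finite E _
  rw [nilradical_eq_sInf, Submodule.mem_sInf]
  intro (P : Ideal (E ⊗[k] Z)) (hP : P.IsPrime)
  have : P.IsMaximal := inferInstance
  let : Field ((E ⊗[k] Z) ⧸ P) := Ideal.Quotient.field P
  have hbij : Function.Bijective (algebraMap E ((E ⊗[k] Z) ⧸ P)) :=
    IsAlgClosed.algebraMap_bijective_of_isIntegral
  let e : E ≃ₐ[E] ((E ⊗[k] Z) ⧸ P) := AlgEquiv.ofBijective (Algebra.ofId E _) hbij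
  let χ : E ⊗[k] Z →ₐ[E] E := e.symm.toAlgHom.comp (Ideal.Quotient.mkₐ E P)
  have hχ : ∀ s, χ s = 0 → s ∈ P := fun s hs => by
    have : e.symm (Ideal.Quotient.mk P s) = 0 := hs
    rwa [map_eq_zero_iff _ e.symm.injective, Ideal.Quotient.eq_zero_iff_mem] at this
  let χ₀ : Z →ₐ[k] E := (χ.restrictScalars k).comp Algebra.TensorProduct.includeRight
  let χΩ : Ω ⊗[k] Z →ₐ[Ω] Ω := Algebra.TensorProduct.lift (Algebra.ofId Ω Ω)
    ((IsScalarTower.toAlgHom k E Ω).comp χ₀) fun _ _ => Commute.all _ _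
  have hcomp : ∀ t, χ (functionalTensor k Z ρ t) = ρ (χΩ t) := fun t => by
    induction t with
    | zero => simp
    | add a b ha hb => simp only [map_add, ha, hb]
    | tmul a z =>
      have h1 : χΩ (a ⊗ₜ z) = χ₀ z • a := by
        simp [χΩ, Algebra.smul_def, mul_comm]
      rw [h1, map_smul, functionalTensor_tmul,
        show ρ a ⊗ₜ[k] z = ρ a • (1 ⊗ₜ z) by simp [TensorProduct.smul_tmul'], map_smul]
      simp [χ₀, mul_comm]
  refine hχ _ ?_
  rw [hcomp, ((mem_nilradical.1 ht).map χΩ).eq_zero, map_zero]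

end Nilradical

/-- Embed both K and E into an algebraic closure Ω of E over F. Over Ω the nilradical comes from K,
hence from F, and membership descends from Ω to E. -/
theorem NilradicalExtends.of_algClosed {k F K Z : Type*} (E : Type*) [Field k] [Field F]
    [Field K] [Field E]
    [CommRing Z] [Algebra k Z] [FiniteDimensional k Z]
    [Algebra k F] [Algebra k K] [Algebra F K] [IsScalarTower k F K] [Algebra k E] [Algebra F E]
    [IsScalarTower k F E] [IsAlgClosed K] [Algebra.IsAlgebraic F K]
    (h : NilradicalExtends (k := k) F K Z) : NilradicalExtends (k := k) F E Z := by
  let Ω := AlgebraicClosure E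
  let f : K →ₐ[F] Ω := IsAlgClosed.lift
  let : Algebra K Ω := f.toRingHom.toAlgebra
  have hFK : IsScalarTower F K Ω := IsScalarTower.of_algebraMap_eq fun x => (f.commutes x).symm
  have hkF : IsScalarTower k F Ω := IsScalarTower.of_algebraMap_eq fun x => by
    rw [IsScalarTower.algebraMap_apply k E Ω, IsScalarTower.algebraMap_apply k F E,
      ← IsScalarTower.algebraMap_apply F E Ω]
  have hkK : IsScalarTower k K Ω := IsScalarTower.of_algebraMap_eq fun x => by
    rw [IsScalarTower.algebraMap_apply k F Ω, IsScalarTower.algebraMap_apply k F K,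
      ← IsScalarTower.algebraMap_apply F K Ω]
  have hΩ : NilradicalExtends (k := k) K Ω Z := nilradicalExtends_of_isAlgClosed
  have hcomp₁ : ∀ s, extendScalarsHom k Ω Z (extendScalarsHom k K Z s : K ⊗[k] Z) =
      extendScalarsHom k Ω Z (s : F ⊗[k] Z) := fun s => by
    induction s with
    | zero => simp
    | add a b ha hb => simp only [map_add, ha, hb]
    | tmul a z => simp [← IsScalarTower.algebraMap_apply F K Ω]
  have hcomp₂ : ∀ s, extendScalarsHom k Ω Z (extendScalarsHom k E Z s : E ⊗[k] Z) =
      extendScalarsHom k Ω Z (s : F ⊗[k] Z) := fun s => by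
    induction s with
    | zero => simp
    | add a b ha hb => simp only [map_add, ha, hb]
    | tmul a z => simp [← IsScalarTower.algebraMap_apply F E Ω]
  refine le_antisymm (fun t ht => ?_) map_nilradical_le
  rw [← extendScalarsHom_mem_map_iff (Ω := Ω)]
  have h1 : extendScalarsHom k Ω Z t ∈ nilradical (Ω ⊗[k] Z) :=
    mem_nilradical.2 ((mem_nilradical.1 ht).map _)
  rw [NilradicalExtends] at hΩ h
  rw [hΩ, h] at h1
  refine (?_ : Ideal.map _ _ ≤ _) h1
  rw [Ideal.map_le_iff_le_comap, Ideal.map_le_iff_le_comap]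
  intro s hs
  rw [Ideal.mem_comap, Ideal.mem_comap, hcomp₁, ← hcomp₂]
  exact Ideal.mem_map_of_mem _ (Ideal.mem_map_of_mem _ hs)

/-! ### Multiplications on a central simple algebra. -/

section Multiplication

variable (Z C : Type*) [Field Z] [Ring C] [Algebra Z C]

/-- The algebra of endomorphisms of `C` generated by left and right multiplications. -/
def multiplicationAlgebra : Subalgebra Z (Module.End Z C) :=
  Algebra.adjoin Z (Set.range (LinearMap.mulLeft Z (A := C)) ∪ Set.range (LinearMap.mulRight Z))

variable {Z C}

theorem mulLeft_mem_multiplicationAlgebra (c : C) :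
    LinearMap.mulLeft Z c ∈ multiplicationAlgebra Z C :=
  Algebra.subset_adjoin (Or.inl ⟨c, rfl⟩)

theorem mulRight_mem_multiplicationAlgebra (c : C) :
    LinearMap.mulRight Z c ∈ multiplicationAlgebra Z C :=
  Algebra.subset_adjoin (Or.inr ⟨c, rfl⟩)

theorem isSimpleModule_multiplicationAlgebra [IsSimpleRing C] :
    IsSimpleModule (multiplicationAlgebra Z C) C := by
  rw [isSimpleModule_iff]
  refine { exists_pair_ne := ⟨⊥, ⊤, bot_ne_top⟩, eq_bot_or_eq_top := fun P => ?_ }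
  let I : TwoSidedIdeal C := TwoSidedIdeal.mk' P P.zero_mem P.add_mem (fun {x} hx => by
      rw [← neg_one_mul]
      exact P.smul_mem ⟨_, mulLeft_mem_multiplicationAlgebra (-1)⟩ hx)
    (fun {x y} hy => P.smul_mem ⟨_, mulLeft_mem_multiplicationAlgebra x⟩ hy)
    (fun {x y} hx => P.smul_mem ⟨_, mulRight_mem_multiplicationAlgebra y⟩ hx)
  have hI : ∀ c, c ∈ I ↔ c ∈ P := fun c => TwoSidedIdeal.mem_mk' ..
  rcases eq_bot_or_eq_top I with h | h
  · left
    ext c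
    rw [← hI, h, TwoSidedIdeal.mem_bot, Submodule.mem_bot]
  · right
    ext c
    rw [← hI, h]
    simp [TwoSidedIdeal.mem_top]

/-- C is a simple module over the multiplications, and its endomorphisms are the scalars of the
centre, so Jacobson density yields every Z-linear map. -/
theorem multiplicationAlgebra_eq_top [IsSimpleRing C] [Algebra.IsCentral Z C]
    [FiniteDimensional Z C] : multiplicationAlgebra Z C = ⊤ := by
  classical
  have := isSimpleModule_multiplicationAlgebra (Z := Z) (C := C)
  rw [eq_top_iff]
  rintro f -
  have hend : ∀ (g : Module.End (multiplicationAlgebra Z C) C), ∃ z : Z, ∀ c, g c = z • c := by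
    intro g
    have hl : ∀ c d, g (c * d) = c * g d := fun c d =>
      g.map_smul (⟨_, mulLeft_mem_multiplicationAlgebra c⟩ : multiplicationAlgebra Z C) d
    have hr : ∀ c d, g (d * c) = g d * c := fun c d =>
      g.map_smul (⟨_, mulRight_mem_multiplicationAlgebra c⟩ : multiplicationAlgebra Z C) d
    have hc : g 1 ∈ Subalgebra.center Z C := by
      rw [Subalgebra.mem_center_iff]
      intro c
      rw [← hl, mul_one, ← hr, one_mul]
    obtain ⟨z, hz⟩ := (Algebra.IsCentral.mem_center_iff Z).1 hc
    refine ⟨z, fun c => ?_⟩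
    rw [Algebra.smul_def, ← hz, ← hr, one_mul]
  let F : Module.End (Module.End (multiplicationAlgebra Z C) C) C :=
    { toFun := f
      map_add' := f.map_add
      map_smul' := fun g c => by
        obtain ⟨z, hz⟩ := hend g
        rw [RingHom.id_apply, Module.End.smul_def, Module.End.smul_def, hz, hz, f.map_smul] }
  obtain ⟨r, hr⟩ := jacobson_density (R := multiplicationAlgebra Z C) (M := C) F
    (Finset.univ.image (Module.finBasis Z C))
  have : f = r.1 := by
    refine (Module.finBasis Z C).ext fun i => ?_
    exact hr _ (Finset.mem_image_of_mem _ (Finset.mem_univ i))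
  rw [this]
  exact r.2

end Multiplication

/-! ### The Jacobson radical of E ⊗ C for C central simple over Z. -/

section Coordinates

variable {k Z : Type*} (E : Type*) [Field k] [Field Z] [Algebra k Z] [Field E] [Algebra k E]

section Module

variable {V : Type*} [AddCommGroup V] [Module k V] [Module Z V] [IsScalarTower k Z V]

/-- The map `E ⊗ V → E ⊗ Z` induced by a `Z`-linear functional on `V`. -/
noncomputable def coordTensor (f : V →ₗ[Z] Z) : E ⊗[k] V →ₗ[E] E ⊗[k] Z :=
  (f.restrictScalars k).baseChange E

@[simp]
theorem coordTensor_tmul (f : V →ₗ[Z] Z) (e : E) (v : V) :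
    coordTensor E f (e ⊗ₜ[k] v) = e ⊗ₜ f v := rfl

/-- The action of `E ⊗ Z` on `E ⊗ V`. -/
noncomputable def tensorAction (k Z V : Type*) [Field k] [Field Z] [Algebra k Z] [Algebra k E]
    [AddCommGroup V] [Module k V] [Module Z V] [IsScalarTower k Z V] :
    E ⊗[k] Z →ₐ[E] Module.End E (E ⊗[k] V) :=
  Algebra.TensorProduct.lift (Algebra.ofId E _)
    ((Module.End.baseChangeHom k E V).comp (Algebra.lsmul k k V : Z →ₐ[k] Module.End k V))
    fun e _ => show Commute (Algebra.ofId E _ e) _ from Algebra.commutes e _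

@[simp]
theorem tensorAction_tmul (e e' : E) (z : Z) (v : V) :
    tensorAction E k Z V (e ⊗ₜ z) (e' ⊗ₜ v) = (e * e') ⊗ₜ (z • v) := by
  rw [tensorAction, Algebra.TensorProduct.lift_tmul]
  change e • (e' ⊗ₜ[k] (z • v)) = _
  rw [TensorProduct.smul_tmul', smul_eq_mul]

theorem coordTensor_tensorAction (f : V →ₗ[Z] Z) (r : E ⊗[k] Z) (x : E ⊗[k] V) :
    coordTensor E f (tensorAction E k Z V r x) = r * coordTensor E f x := by
  induction r with
  | zero => simp
  | add a b ha hb => simp only [map_add, LinearMap.add_apply, ha, hb, add_mul]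
  | tmul e z =>
    induction x with
    | zero => simp
    | add a b ha hb => simp only [map_add, ha, hb, mul_add]
    | tmul e' v => simp

theorem eq_sum_tensorAction {β : Type*} [Fintype β] (b : Module.Basis β Z V) (x : E ⊗[k] V) :
    x = ∑ i, tensorAction E k Z V (coordTensor E (b.coord i) x) (1 ⊗ₜ b i) := by
  induction x with
  | zero => simp
  | add x y hx hy =>
    simp only [map_add, LinearMap.add_apply, Finset.sum_add_distrib]
    rw [← hx, ← hy]
  | tmul e v =>
    simp only [coordTensor_tmul, tensorAction_tmul, mul_one, ← TensorProduct.tmul_sum]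
    rw [show ∑ i, b.coord i v • b i = v from b.sum_repr v]

end Module

variable {C : Type*} [Ring C] [Algebra k C] [Algebra Z C] [IsScalarTower k Z C]

variable (k Z C) in
/-- The canonical map `E ⊗ Z → E ⊗ C` for a `Z`-algebra `C`. -/
noncomputable def tensorAlgebraMap : E ⊗[k] Z →ₐ[E] E ⊗[k] C :=
  Algebra.TensorProduct.map (AlgHom.id E E) (IsScalarTower.toAlgHom k Z C)

@[simp]
theorem tensorAlgebraMap_tmul (e : E) (z : Z) :
    tensorAlgebraMap k Z E C (e ⊗ₜ z) = e ⊗ₜ algebraMap Z C z := by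
  simp [tensorAlgebraMap]

theorem tensorAlgebraMap_mul (r : E ⊗[k] Z) (x : E ⊗[k] C) :
    tensorAlgebraMap k Z E C r * x = tensorAction E k Z C r x := by
  induction r with
  | zero => simp
  | add a b ha hb => simp only [map_add, add_mul, LinearMap.add_apply, ha, hb]
  | tmul e z =>
    induction x with
    | zero => simp
    | add a b ha hb => simp only [map_add, ha, hb, mul_add]
    | tmul e' v => simp [Algebra.smul_def]

theorem tensorAlgebraMap_commute (r : E ⊗[k] Z) (x : E ⊗[k] C) :
    Commute (tensorAlgebraMap k Z E C r) x := by
  induction r with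
  | zero => simp
  | add a b ha hb => rw [map_add]; exact ha.add_left hb
  | tmul e z =>
    induction x with
    | zero => simp
    | add a b ha hb => exact ha.add_right hb
    | tmul e' v =>
      rw [commute_iff_eq]
      simp [mul_comm e', Algebra.commutes z v]

theorem tensorAlgebraMap_injective [Nontrivial C] :
    Function.Injective (tensorAlgebraMap k Z E C) :=
  Module.Flat.lTensor_preserves_injective_linearMap (M := E)
    (IsScalarTower.toAlgHom k Z C).toLinearMap (algebraMap Z C).injective

variable (k Z C) in
theorem isArtinianRing_tensorProduct [FiniteDimensional k Z] [FiniteDimensional Z C] :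
    IsArtinianRing (E ⊗[k] C) := by
  have : FiniteDimensional k C := FiniteDimensional.trans k Z C
  exact IsArtinianRing.of_finite E _

variable [IsSimpleRing C] [Algebra.IsCentral Z C] [FiniteDimensional Z C]

theorem lTensor_mem_of_isTwoSided {J : Ideal (E ⊗[k] C)} [J.IsTwoSided] (f : Module.End Z C)
    {x : E ⊗[k] C} (hx : x ∈ J) : (f.restrictScalars k).lTensor E x ∈ J := by
  have hf : f ∈ multiplicationAlgebra Z C := by rw [multiplicationAlgebra_eq_top]; trivial
  have hleft : ∀ c : C, ∀ x : E ⊗[k] C,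
      ((LinearMap.mulLeft Z c).restrictScalars k).lTensor E x = (1 ⊗ₜ c) * x := by
    intro c x
    induction x with
    | zero => simp
    | add a b ha hb => simp only [mul_add, map_add, ha, hb]
    | tmul e d => simp
  have hright : ∀ c : C, ∀ x : E ⊗[k] C,
      ((LinearMap.mulRight Z c).restrictScalars k).lTensor E x = x * (1 ⊗ₜ c) := by
    intro c x
    induction x with
    | zero => simp
    | add a b ha hb => simp only [add_mul, map_add, ha, hb]
    | tmul e d => simp
  induction hf using Algebra.adjoin_induction generalizing x with
  | mem f hf =>
    obtain ⟨c, rfl⟩ | ⟨c, rfl⟩ := hf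
    · rw [hleft]; exact J.mul_mem_left _ hx
    · rw [hright]; exact J.mul_mem_right _ hx
  | algebraMap z =>
    have : algebraMap Z (Module.End Z C) z = LinearMap.mulLeft Z (algebraMap Z C z) := by
      ext c
      simp [Module.algebraMap_end_apply, Algebra.smul_def]
    rw [this, hleft]
    exact J.mul_mem_left _ hx
  | add f g _ _ hf hg =>
    rw [LinearMap.restrictScalars_add, LinearMap.lTensor_add, LinearMap.add_apply]
    exact add_mem (hf hx) (hg hx)
  | mul f g _ _ hf hg =>
    rw [Module.End.mul_eq_comp, LinearMap.restrictScalars_comp, LinearMap.lTensor_comp,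
      LinearMap.comp_apply]
    exact hf (hg hx)

/-- Viewed in E ⊗ C, a coordinate is the effect of a Z-linear endomorphism of C, which preserves
two-sided ideals. It thus stays in the radical, which is nilpotent because the ring is Artinian. -/
theorem coordTensor_mem_nilradical_of_mem_jacobson [FiniteDimensional k Z] (f : C →ₗ[Z] Z)
    {x : E ⊗[k] C} (hx : x ∈ Ring.jacobson (E ⊗[k] C)) :
    coordTensor E f x ∈ nilradical (E ⊗[k] Z) := by
  have := isArtinianRing_tensorProduct k Z E C
  have h1 : tensorAlgebraMap k Z E C (coordTensor E f x) =
      (((Algebra.linearMap Z C).comp f).restrictScalars k).lTensor E x := by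
    clear hx
    induction x with
    | zero => simp
    | add a b ha hb => simp only [map_add, ha, hb]
    | tmul e c => simp
  have h2 : tensorAlgebraMap k Z E C (coordTensor E f x) ∈ Ring.jacobson (E ⊗[k] C) := by
    rw [h1]
    exact lTensor_mem_of_isTwoSided E _ hx
  obtain ⟨n, hn⟩ := IsSemiprimaryRing.isNilpotent (R := E ⊗[k] C)
  refine mem_nilradical.2 ⟨n, tensorAlgebraMap_injective (C := C) E ?_⟩
  have := Ideal.pow_mem_pow h2 n
  rw [hn] at this
  rw [map_pow, map_zero]
  exact this

variable (k Z C) in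
theorem jacobson_tensorProduct_eq_map [FiniteDimensional k Z] :
    Ring.jacobson (E ⊗[k] C) = (nilradical (E ⊗[k] Z)).map (tensorAlgebraMap k Z E C) := by
  apply le_antisymm
  · intro x hx
    rw [eq_sum_tensorAction E (Module.finBasis Z C) x]
    refine sum_mem fun i _ => ?_
    rw [← tensorAlgebraMap_mul, (tensorAlgebraMap_commute E _ _).eq]
    exact Ideal.mul_mem_left _ _ (Ideal.mem_map_of_mem _
      (coordTensor_mem_nilradical_of_mem_jacobson E _ hx))
  · rw [Ideal.map_le_iff_le_comap]
    intro r hr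
    rw [Ideal.mem_comap, ← Ideal.jacobson_bot, Ideal.mem_jacobson_iff]
    intro y
    -- The image of E ⊗ Z is central, so any multiple of a nilpotent r is nilpotent and 1 + y r is a
    -- unit.
    have hnil : IsNilpotent (y * tensorAlgebraMap k Z E C r) :=
      (tensorAlgebraMap_commute E r y).symm.isNilpotent_mul_left ((mem_nilradical.1 hr).map _)
    obtain ⟨u, hu⟩ := hnil.isUnit_one_add
    refine ⟨(u⁻¹ : (E ⊗[k] C)ˣ), ?_⟩
    have h2 : ((u⁻¹ : (E ⊗[k] C)ˣ) : E ⊗[k] C) * (1 + y * tensorAlgebraMap k Z E C r) = 1 := by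
      rw [← hu, Units.inv_mul]
    rw [Ideal.mem_bot, sub_eq_zero, mul_assoc, ← h2, mul_add, mul_one, add_comm]

end Coordinates

/-! ### Modules over Artinian rings and their Jacobson radical. -/

section ModuleTheory

variable {S X : Type*} [Ring S] [AddCommGroup X] [Module S X]

theorem isSemisimpleModule_of_jacobson_smul_eq_zero [IsArtinianRing S]
    (h : ∀ s ∈ Ring.jacobson S, ∀ x : X, s • x = 0) : IsSemisimpleModule S X := by
  have ht : Module.IsTorsionBySet S X (Ring.jacobson S) := fun x s => h s s.2 x
  let _ := ht.module
  exact (ht.semilinearMap.isSemisimpleModule_iff_of_bijective Function.bijective_id).2 inferInstance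

/-- P/L is killed by the radical, hence semisimple; a complement of Q/L there is pulled back. -/
theorem exists_relative_complement [IsArtinianRing S] {L P Q : Submodule S X}
    (h : ∀ s ∈ Ring.jacobson S, ∀ x ∈ P, s • x ∈ L) (hLQ : L ≤ Q) (hQP : Q ≤ P) :
    ∃ R, L ≤ R ∧ R ≤ P ∧ Q ⊔ R = P ∧ Q ⊓ R = L := by
  have hss : IsSemisimpleModule S (P.map L.mkQ) := by
    refine isSemisimpleModule_of_jacobson_smul_eq_zero ?_
    rintro s hs ⟨_, x, hx, rfl⟩
    ext
    change s • L.mkQ x = 0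
    rw [← map_smul, Submodule.mkQ_apply, Submodule.Quotient.mk_eq_zero]
    exact h s hs x hx
  obtain ⟨R', hR'⟩ := exists_isCompl ((Q.map L.mkQ).comap (P.map L.mkQ).subtype)
  set R₀ := R'.map (P.map L.mkQ).subtype with hR₀
  have hQ₀ : ((Q.map L.mkQ).comap (P.map L.mkQ).subtype).map (P.map L.mkQ).subtype = Q.map L.mkQ := by
    rw [Submodule.map_comap_subtype, inf_eq_right]
    exact Submodule.map_mono hQP
  have hsup : Q.map L.mkQ ⊔ R₀ = P.map L.mkQ := by
    rw [← hQ₀, hR₀, ← Submodule.map_sup, hR'.sup_eq_top, Submodule.map_top, Submodule.range_subtype]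
  have hinf : Q.map L.mkQ ⊓ R₀ = ⊥ := by
    rw [← hQ₀, hR₀, ← Submodule.map_inf _ (Submodule.subtype_injective _), hR'.inf_eq_bot,
      Submodule.map_bot]
  have hcomap : ∀ N : Submodule S X, L ≤ N → (N.map L.mkQ).comap L.mkQ = N := fun N hN => by
    rw [Submodule.comap_map_mkQ, sup_eq_right.2 hN]
  have hLR : L ≤ R₀.comap L.mkQ := by
    conv_lhs => rw [← Submodule.ker_mkQ L]
    exact LinearMap.ker_le_comap _
  have hR₀map : (R₀.comap L.mkQ).map L.mkQ = R₀ :=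
    Submodule.map_comap_eq_of_surjective (Submodule.mkQ_surjective L) _
  refine ⟨R₀.comap L.mkQ, hLR, ?_, ?_, ?_⟩
  · rw [← hcomap P (hLQ.trans hQP), ← hsup]
    exact Submodule.comap_mono le_sup_right
  · rw [← hcomap (Q ⊔ R₀.comap L.mkQ) (hLQ.trans le_sup_left), Submodule.map_sup, hR₀map, hsup,
      hcomap P (hLQ.trans hQP)]
  · rw [← hcomap Q hLQ, ← Submodule.comap_inf, hinf]
    simpa only [Submodule.mkQ_map_self] using hcomap L le_rfl

theorem sup_sSup_covBy_eq [IsArtinianRing S] [IsArtinian S X] {L P : Submodule S X} (hLP : L ≤ P)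
    (h : ∀ s ∈ Ring.jacobson S, ∀ x ∈ P, s • x ∈ L) :
    L ⊔ sSup {N | N ≤ P ∧ L ⋖ N} = P := by
  set Q := L ⊔ sSup {N | N ≤ P ∧ L ⋖ N} with hQ
  have hQP : Q ≤ P := sup_le hLP (sSup_le fun N hN => hN.1)
  obtain ⟨R, hLR, hRP, hsup, hinf⟩ := exists_relative_complement h le_sup_left hQP
  rcases hLR.eq_or_lt with rfl | hlt
  · rw [← hsup, eq_comm, sup_eq_left]
    exact le_sup_left
  · exfalso
    obtain ⟨N, hN, hNR⟩ := exists_covBy_le_of_lt hlt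
    have hNQ : N ≤ Q := (le_sSup (show N ∈ {N | N ≤ P ∧ L ⋖ N} from ⟨hNR.trans hRP, hN⟩)).trans
      le_sup_right
    exact hN.lt.not_ge ((le_inf hNQ hNR).trans hinf.le)

theorem inf_sInf_covBy_le [IsArtinianRing S] [IsNoetherian S X] {L P : Submodule S X} (hLP : L ≤ P)
    (h : ∀ s ∈ Ring.jacobson S, ∀ x ∈ P, s • x ∈ L) :
    P ⊓ sInf {N | L ≤ N ∧ N ⋖ P} ≤ L := by
  set Q := P ⊓ sInf {N | L ≤ N ∧ N ⋖ P} with hQ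
  have hLQ : L ≤ Q := le_inf hLP (le_sInf fun N hN => hN.1)
  obtain ⟨R, hLR, hRP, hsup, hinf⟩ := exists_relative_complement h hLQ inf_le_left
  rcases hRP.eq_or_lt with rfl | hlt
  · rw [← hinf]
    exact le_inf le_rfl inf_le_left
  · exfalso
    obtain ⟨N, hRN, hN⟩ := exists_le_covBy_of_lt hlt
    have hQN : Q ≤ N := inf_le_right.trans
      (sInf_le (show N ∈ {N | L ≤ N ∧ N ⋖ P} from ⟨hLR.trans hRN, hN⟩))
    exact hN.lt.not_ge (hsup.symm.le.trans (sup_le hQN hRN))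

theorem jacobson_smul_mem_of_covBy {L P : Submodule S X} (h : L ⋖ P) {s : S}
    (hs : s ∈ Ring.jacobson S) {x : X} (hx : x ∈ P) : s • x ∈ L := by
  have := (covBy_iff_quot_is_simple h.le).1 h
  have h2 := Module.mem_annihilator.1 (IsSemisimpleModule.jacobson_le_annihilator S
    (P ⧸ Submodule.comap P.subtype L) hs) (Submodule.Quotient.mk ⟨x, hx⟩)
  rw [← Submodule.Quotient.mk_smul, Submodule.Quotient.mk_eq_zero] at h2
  exact h2

variable (X) in
/-- The submodule of elements killed by a two-sided ideal. -/
def Ideal.torsionSubmodule (I : Ideal S) [I.IsTwoSided] : Submodule S X where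
  carrier := {x | ∀ s ∈ I, s • x = 0}
  add_mem' ha hb s hs := by rw [smul_add, ha s hs, hb s hs, add_zero]
  zero_mem' s _ := smul_zero s
  smul_mem' t x hx s hs := by rw [← mul_smul]; exact hx _ (I.mul_mem_right t hs)

theorem mem_torsionSubmodule_pow_succ {I : Ideal S} [I.IsTwoSided] {x : X} {i : ℕ} :
    x ∈ (I ^ (i + 1)).torsionSubmodule X ↔ ∀ s ∈ I, s • x ∈ (I ^ i).torsionSubmodule X := by
  constructor
  · intro h s hs t ht
    rw [← mul_smul]
    exact h _ (Ideal.mul_mem_mul ht hs)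
  · intro h s hs
    rw [Submodule.pow_succ, ← smul_eq_mul] at hs
    refine Submodule.smul_induction_on (p := fun s => s • x = 0) hs (fun t ht u hu => ?_)
      fun a b ha hb => ?_
    · rw [smul_eq_mul, mul_smul]
      exact h u hu t ht
    · rw [add_smul, ha, hb, add_zero]

end ModuleTheory

/-! ### Socle and radical series through powers of the Jacobson radical. -/

namespace GModule

section Rigid

variable {E A X S : Type*} [Field E] [CommRing A] [HopfAlgebra E A] [AddCommGroup X] [Module E X]
  [Ring S] [Algebra E S] [Module S X] [IsScalarTower E S X] {M : GModule E A X}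

theorem isSimpleQuot_restrictScalars_iff
    (hsub : ∀ W, M.IsSub W ↔ ∃ W' : Submodule S X, W'.restrictScalars E = W)
    {L N : Submodule S X} :
    M.IsSimpleQuot (L.restrictScalars E) (N.restrictScalars E) ↔ L ⋖ N := by
  constructor
  · rintro ⟨-, -, hlt, hmin⟩
    refine ⟨hlt, fun P hLP hPN => ?_⟩
    rcases hmin (P.restrictScalars E) ((hsub _).2 ⟨P, rfl⟩) hLP.le hPN.le with h | h
    · exact hLP.ne' (Submodule.restrictScalars_injective E S X h)
    · exact hPN.ne (Submodule.restrictScalars_injective E S X h)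
  · intro h
    refine ⟨(hsub _).2 ⟨L, rfl⟩, (hsub _).2 ⟨N, rfl⟩, h.lt, fun P hP hLP hPN => ?_⟩
    obtain ⟨P, rfl⟩ := (hsub _).1 hP
    rcases h.eq_or_eq (c := P) hLP hPN with rfl | rfl
    · exact Or.inl rfl
    · exact Or.inr rfl

/-- Successive annihilator layers are killed by the radical, hence are sums of simples; conversely
the radical kills every simple layer. -/
theorem socleSeries_restrictScalars [IsArtinianRing S] [IsArtinian S X]
    (hsub : ∀ W, M.IsSub W ↔ ∃ W' : Submodule S X, W'.restrictScalars E = W)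
    (U : Submodule S X) (i : ℕ) :
    M.socleSeries (U.restrictScalars E) i =
      (U ⊓ (Ring.jacobson S ^ i).torsionSubmodule X).restrictScalars E := by
  induction i with
  | zero =>
    rw [socleSeries, eq_comm, Submodule.restrictScalars_eq_bot_iff, eq_bot_iff]
    rintro x ⟨-, hx⟩
    simpa using hx 1 (by rw [Submodule.pow_zero, Ideal.one_eq_top]; trivial)
  | succ i ih =>
    rw [socleSeries, ih]
    set L := U ⊓ (Ring.jacobson S ^ i).torsionSubmodule X with hL
    set P := U ⊓ (Ring.jacobson S ^ (i + 1)).torsionSubmodule X with hP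
    have hLP : L ≤ P := inf_le_inf_left _ fun x hx s hs => hx s (Ideal.pow_le_pow_right i.le_succ hs)
    have hJ : ∀ s ∈ Ring.jacobson S, ∀ x ∈ P, s • x ∈ L := fun s hs x hx =>
      ⟨U.smul_mem s hx.1, mem_torsionSubmodule_pow_succ.1 hx.2 s hs⟩
    apply le_antisymm
    · refine sup_le hLP (sSup_le ?_)
      rintro N ⟨hNU, hN⟩
      obtain ⟨N, rfl⟩ := (hsub N).1 hN.2.1
      rw [isSimpleQuot_restrictScalars_iff hsub] at hN
      exact fun x hx => ⟨hNU hx, mem_torsionSubmodule_pow_succ.2 fun s hs =>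
        (jacobson_smul_mem_of_covBy hN hs hx).2⟩
    · have h1 := sup_sSup_covBy_eq hLP hJ
      let T : Submodule S X := sSup {N | N ≤ P ∧ L ⋖ N}
      have h2 : T.restrictScalars E ≤ sSup {N | N ≤ U.restrictScalars E ∧
          M.IsSimpleQuot (L.restrictScalars E) N} := by
        change (sSup {N | N ≤ P ∧ L ⋖ N}).restrictScalars E ≤ _
        rw [Submodule.restrictScalars_sSup]
        refine sSup_le_sSup ?_
        rintro _ ⟨N, ⟨hNP, hN⟩, rfl⟩
        exact ⟨fun x hx => (hNP hx).1, (isSimpleQuot_restrictScalars_iff hsub).2 hN⟩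
      rw [← h1, Submodule.restrictScalars_sup]
      exact sup_le_sup_left h2 _

theorem radicalSeries_restrictScalars [IsArtinianRing S] [IsNoetherian S X]
    (hsub : ∀ W, M.IsSub W ↔ ∃ W' : Submodule S X, W'.restrictScalars E = W)
    (U : Submodule S X) (i : ℕ) :
    M.radicalSeries (U.restrictScalars E) i = ((Ring.jacobson S ^ i) • U).restrictScalars E := by
  induction i with
  | zero => rw [radicalSeries, Submodule.pow_zero, Ideal.one_eq_top, Submodule.top_smul]
  | succ i ih =>
    rw [radicalSeries, ih]
    set P := (Ring.jacobson S ^ i) • U with hP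
    set L := (Ring.jacobson S ^ (i + 1)) • U with hL
    have hLJ : L = Ring.jacobson S • P := by
      rcases eq_or_ne i 0 with rfl | hi
      · rw [hL, hP, Submodule.pow_one, Submodule.pow_zero, Ideal.one_eq_top, Submodule.top_smul]
      · rw [hL, hP, Submodule.pow_succ' _ hi, ← smul_eq_mul, Submodule.smul_assoc]
    have hLP : L ≤ P := hLJ.le.trans Submodule.smul_le_right
    have hJ : ∀ s ∈ Ring.jacobson S, ∀ x ∈ P, s • x ∈ L := fun s hs x hx =>
      hLJ ▸ Submodule.smul_mem_smul hs hx
    apply le_antisymm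
    · refine le_trans ?_ (show (P ⊓ sInf {N | L ≤ N ∧ N ⋖ P}).restrictScalars E ≤
        L.restrictScalars E from inf_sInf_covBy_le hLP hJ)
      intro x hx
      refine ⟨hx.1, Submodule.mem_sInf.2 fun N hN => ?_⟩
      exact Submodule.mem_sInf.1 hx.2 _ ((isSimpleQuot_restrictScalars_iff hsub).2 hN.2)
    · refine le_inf hLP (le_sInf fun N hN => ?_)
      obtain ⟨N, rfl⟩ := (hsub N).1 hN.1
      rw [Set.mem_ofPred_eq, isSimpleQuot_restrictScalars_iff hsub] at hN
      change L ≤ N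
      rw [hLJ, Submodule.smul_le]
      exact fun s hs x hx => jacobson_smul_mem_of_covBy hN hs hx

/-- The inclusion passes from X to a direct summand by splitting off components, and the reverse one
follows from J^ℓ = 0. Every nonzero summand has the same Loewy length ℓ: a shorter one would give J
U = U, hence U = J^ℓ U = 0. -/
theorem isRigid_of_torsion_le [IsArtinianRing S] [Module.Finite S X]
    (hsub : ∀ W, M.IsSub W ↔ ∃ W' : Submodule S X, W'.restrictScalars E = W)
    {ℓ : ℕ} (hℓ : Ring.jacobson S ^ ℓ = ⊥)
    (h : ∀ i ≤ ℓ, (Ring.jacobson S ^ i).torsionSubmodule X ≤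
      (Ring.jacobson S ^ (ℓ - i)) • (⊤ : Submodule S X)) : M.IsRigid := by
  rintro U ⟨hU, ⟨W, hW, hUW⟩, hne, -⟩
  obtain ⟨U, rfl⟩ := (hsub U).1 hU
  obtain ⟨W, rfl⟩ := (hsub W).1 hW
  have hdisj : U ⊓ W = ⊥ := by
    apply Submodule.restrictScalars_injective E S X
    exact hUW.inf_eq_bot
  have hsup : U ⊔ W = ⊤ := by
    apply Submodule.restrictScalars_injective E S X
    rw [Submodule.restrictScalars_sup]
    exact hUW.sup_eq_top
  have key : ∀ i ≤ ℓ, U ⊓ (Ring.jacobson S ^ i).torsionSubmodule X =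
      (Ring.jacobson S ^ (ℓ - i)) • U := by
    intro i hi
    apply le_antisymm
    · rintro x ⟨hxU, hx⟩
      have h1 := h i hi hx
      rw [← hsup, Submodule.smul_sup, Submodule.mem_sup] at h1
      obtain ⟨u, hu, w, hw, rfl⟩ := h1
      have huU : u ∈ U := Submodule.smul_le_right hu
      have hw0 : w ∈ U ⊓ W := ⟨(U.add_mem_iff_right huU).1 hxU, Submodule.smul_le_right hw⟩
      rw [hdisj, Submodule.mem_bot] at hw0
      rwa [hw0, add_zero]
    · refine le_inf Submodule.smul_le_right ?_
      rw [Submodule.smul_le]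
      intro s hs x _ t ht
      rw [← mul_smul]
      have hts : t * s ∈ Ring.jacobson S ^ ℓ := by
        rcases hi.eq_or_lt with rfl | hlt
        · exact Ideal.mul_mem_right _ _ ht
        · rw [← Nat.add_sub_cancel' hi, Submodule.pow_add _ (by omega)]
          exact Ideal.mul_mem_mul ht hs
      rw [hℓ, Ideal.mem_bot] at hts
      rw [hts, zero_smul]
  refine ⟨ℓ, ⟨?_, fun n hn => ?_⟩, fun i hi => ?_⟩
  · rw [Set.mem_ofPred_eq, socleSeries_restrictScalars hsub, key ℓ le_rfl, Nat.sub_self,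
      Submodule.pow_zero,
      Ideal.one_eq_top, Submodule.top_smul]
  · by_contra! hlt
    rw [Set.mem_ofPred_eq, socleSeries_restrictScalars hsub, key n hlt.le] at hn
    have hn' : (Ring.jacobson S ^ (ℓ - n)) • U = U := Submodule.restrictScalars_injective E S X hn
    apply hne
    have hU' : Ring.jacobson S • U = U := by
      refine le_antisymm Submodule.smul_le_right ?_
      conv_lhs => rw [← hn']
      exact Submodule.smul_mono_left (Ideal.pow_le_self (by omega))
    have hpow : ∀ m, (Ring.jacobson S ^ m) • U = U := fun m => by
      induction m with
      | zero => rw [Submodule.pow_zero, Ideal.one_eq_top, Submodule.top_smul]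
      | succ m ih => rw [Submodule.pow_succ, ← smul_eq_mul, Submodule.smul_assoc, hU', ih]
    have h0 := hpow ℓ
    rw [hℓ, Submodule.bot_smul] at h0
    rw [← h0]
    rfl
  · rw [socleSeries_restrictScalars hsub, radicalSeries_restrictScalars hsub, key i hi]

end Rigid
end GModule

/-! ### Rigidity depends only on the lattice of submodules. -/

namespace GModule

section Transport

variable {E A X A' X' : Type*} [Field E] [CommRing A] [HopfAlgebra E A] [AddCommGroup X]
  [Module E X] [CommRing A'] [HopfAlgebra E A'] [AddCommGroup X'] [Module E X']
  {M : GModule E A X} {M' : GModule E A' X'} (o : Submodule E X ≃o Submodule E X')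

theorem isSimpleQuot_orderIso (ho : ∀ W, M.IsSub W ↔ M'.IsSub (o W))
    (L N : Submodule E X) :
    M.IsSimpleQuot L N ↔ M'.IsSimpleQuot (o L) (o N) := by
  simp only [IsSimpleQuot, ho, o.surjective.forall, o.le_iff_le, o.lt_iff_lt, o.injective.eq_iff]

theorem socleSeries_orderIso (ho : ∀ W, M.IsSub W ↔ M'.IsSub (o W))
    (U : Submodule E X) (i : ℕ) :
    M'.socleSeries (o U) i = o (M.socleSeries U i) := by
  induction i with
  | zero => simp [socleSeries]
  | succ i ih =>
    rw [socleSeries, socleSeries, ih, map_sup, OrderIso.map_sSup_eq_sSup_symm_preimage]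
    congr 2
    ext N
    obtain ⟨N, rfl⟩ := o.surjective N
    simp [isSimpleQuot_orderIso o ho]

theorem radicalSeries_orderIso (ho : ∀ W, M.IsSub W ↔ M'.IsSub (o W))
    (U : Submodule E X) (i : ℕ) :
    M'.radicalSeries (o U) i = o (M.radicalSeries U i) := by
  induction i with
  | zero => simp [radicalSeries]
  | succ i ih =>
    rw [radicalSeries, radicalSeries, ih, map_inf, OrderIso.map_sInf_eq_sInf_symm_preimage]
    congr 2
    ext N
    obtain ⟨N, rfl⟩ := o.surjective N
    simp [isSimpleQuot_orderIso o ho]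

theorem isIndecomposableSummand_orderIso (ho : ∀ W, M.IsSub W ↔ M'.IsSub (o W))
    (U : Submodule E X) :
    M.IsIndecomposableSummand U ↔ M'.IsIndecomposableSummand (o U) := by
  have h0 : ∀ W, W = ⊥ ↔ o W = ⊥ := fun W => by rw [← o.map_bot, o.injective.eq_iff]
  simp only [IsIndecomposableSummand, ho, o.surjective.forall, o.surjective.exists,
    ← o.isCompl_iff, disjoint_map_orderIso_iff, ← map_sup, o.injective.eq_iff, ← h0, ne_eq]

theorem IsRigid.of_orderIso (ho : ∀ W, M.IsSub W ↔ M'.IsSub (o W))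
    (hM : M.IsRigid) : M'.IsRigid := by
  intro U hU
  obtain ⟨U, rfl⟩ := o.surjective U
  obtain ⟨ℓ, hℓ, h⟩ := hM U ((isIndecomposableSummand_orderIso o ho U).2 hU)
  refine ⟨ℓ, ?_, fun i hi => ?_⟩
  · simpa only [socleSeries_orderIso o ho, o.injective.eq_iff] using hℓ
  · rw [socleSeries_orderIso o ho, radicalSeries_orderIso o ho, h i hi]

end Transport

end GModule

/-! ### Operators given by the coefficients of the coaction. -/

namespace GModule

section Coefficients

variable {k A V : Type*} [Field k] [CommRing A] [HopfAlgebra k A] [AddCommGroup V] [Module k V]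

/-- Contraction of the second factor of `V ⊗ A` by a functional. -/
noncomputable def contract (V : Type*) [AddCommGroup V] [Module k V] (φ : A →ₗ[k] k) :
    V ⊗[k] A →ₗ[k] V :=
  (TensorProduct.rid k V).toLinearMap ∘ₗ φ.lTensor V

@[simp]
theorem contract_tmul (φ : A →ₗ[k] k) (v : V) (a : A) : contract V φ (v ⊗ₜ a) = φ a • v := by
  simp [contract]

theorem contract_rTensor {W : Type*} [AddCommGroup W] [Module k W] (f : W →ₗ[k] V)
    (φ : A →ₗ[k] k) (t : W ⊗[k] A) : contract V φ (f.rTensor A t) = f (contract W φ t) := by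
  induction t with
  | zero => simp
  | add a b ha hb => simp only [map_add, ha, hb]
  | tmul w a => simp

theorem exists_eq_sum_contract {ι : Type*} (b : Module.Basis ι k A) (t : V ⊗[k] A) :
    ∃ s : Finset ι, (∀ i ∉ s, contract V (b.coord i) t = 0) ∧
      t = ∑ i ∈ s, contract V (b.coord i) t ⊗ₜ b i := by
  classical
  suffices H : ∃ s : Finset ι, ∀ s', s ⊆ s' → (∀ i ∉ s', contract V (b.coord i) t = 0) ∧
      t = ∑ i ∈ s', contract V (b.coord i) t ⊗ₜ b i by
    obtain ⟨s, hs⟩ := H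
    exact ⟨s, hs s subset_rfl⟩
  induction t with
  | zero => exact ⟨∅, fun s' _ => by simp⟩
  | add x y hx hy =>
    obtain ⟨s, hs⟩ := hx
    obtain ⟨s₂, hs₂⟩ := hy
    refine ⟨s ∪ s₂, fun s' h => ?_⟩
    have h1 := hs _ (Finset.union_subset_left h)
    have h2 := hs₂ _ (Finset.union_subset_right h)
    refine ⟨fun i hi => by rw [map_add, h1.1 i hi, h2.1 i hi, add_zero], ?_⟩
    simp only [map_add, TensorProduct.add_tmul, Finset.sum_add_distrib]
    rw [← h1.2, ← h2.2]
  | tmul v a =>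
    refine ⟨(b.repr a).support, fun s' h => ⟨fun i hi => ?_, ?_⟩⟩
    · rw [contract_tmul, b.coord_apply, Finsupp.notMem_support_iff.1 fun h' => hi (h h'), zero_smul]
    · conv_lhs => rw [← b.linearCombination_repr a, Finsupp.linearCombination_apply,
        Finsupp.sum_of_support_subset _ h _ (by simp), TensorProduct.tmul_sum]
      refine Finset.sum_congr rfl fun i _ => ?_
      rw [contract_tmul, b.coord_apply, TensorProduct.smul_tmul]

theorem eq_of_contract_eq {ι : Type*} (b : Module.Basis ι k A) {t u : V ⊗[k] A}
    (h : ∀ i, contract V (b.coord i) t = contract V (b.coord i) u) : t = u := by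
  rw [← sub_eq_zero]
  obtain ⟨s, -, hs⟩ := exists_eq_sum_contract b (t - u)
  rw [hs]
  refine Finset.sum_eq_zero fun i _ => ?_
  rw [map_sub, h, sub_self, TensorProduct.zero_tmul]

/-- The operator on `V` given by a functional on the coordinate ring. -/
noncomputable def op (M : GModule k A V) (φ : A →ₗ[k] k) : Module.End k V :=
  contract V φ ∘ₗ M.coact

theorem op_apply (M : GModule k A V) (φ : A →ₗ[k] k) (v : V) :
    M.op φ v = contract V φ (M.coact v) := rfl

variable {ι : Type*} (b : Module.Basis ι k A) (M : GModule k A V)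

theorem isSub_iff_op {W : Submodule k V} :
    M.IsSub W ↔ ∀ i, ∀ w ∈ W, M.op (b.coord i) w ∈ W := by
  constructor
  · intro h i w hw
    obtain ⟨t, ht⟩ := h w hw
    rw [op_apply, ← ht, contract_rTensor]
    exact (contract W (b.coord i) t).2
  · intro h w hw
    obtain ⟨s, -, hs⟩ := exists_eq_sum_contract b (M.coact w)
    rw [hs]
    refine sum_mem fun i _ => ⟨⟨M.op (b.coord i) w, h i w hw⟩ ⊗ₜ b i, ?_⟩
    rw [LinearMap.rTensor_tmul]
    rfl

theorem mem_endAlgebra_iff_op {f : Module.End k V} :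
    f ∈ M.endAlgebra ↔ ∀ i, f * M.op (b.coord i) = M.op (b.coord i) * f := by
  change M.coact ∘ₗ f = f.rTensor A ∘ₗ M.coact ↔ _
  constructor
  · intro h i
    ext v
    rw [Module.End.mul_apply, Module.End.mul_apply, op_apply, op_apply, ← contract_rTensor]
    have := LinearMap.congr_fun h v
    rw [LinearMap.comp_apply, LinearMap.comp_apply] at this
    rw [this]
  · intro h
    ext v
    refine eq_of_contract_eq b fun i => ?_
    rw [LinearMap.comp_apply, LinearMap.comp_apply, contract_rTensor]
    exact (LinearMap.congr_fun (h i) v).symm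

theorem op_mem_span (φ : A →ₗ[k] k) (v : V) :
    M.op φ v ∈ Submodule.span k (Set.range fun i => M.op (b.coord i) v) := by
  obtain ⟨s, -, hs⟩ := exists_eq_sum_contract b (M.coact v)
  rw [op_apply, hs, map_sum]
  refine sum_mem fun i _ => ?_
  rw [contract_tmul]
  exact Submodule.smul_mem _ _ (Submodule.subset_span ⟨i, rfl⟩)

theorem op_counit (v : V) : M.op Coalgebra.counit v = v :=
  LinearMap.congr_fun M.counit v

theorem op_op (φ ψ : A →ₗ[k] k) (v : V) :
    M.op φ (M.op ψ v) =
      M.op ((LinearMap.mul' k k) ∘ₗ TensorProduct.map φ ψ ∘ₗ Coalgebra.comul) v := by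
  have h := LinearMap.congr_fun M.coassoc v
  simp only [LinearMap.comp_apply, LinearEquiv.coe_coe] at h
  have h1 : ∀ t : V ⊗[k] A, contract V (LinearMap.mul' k k ∘ₗ TensorProduct.map φ ψ)
      (TensorProduct.assoc k V A A (M.coact.rTensor A t)) = M.op φ (contract V ψ t) := by
    intro t
    induction t with
    | zero => simp
    | add a b ha hb => simp only [map_add, ha, hb]
    | tmul w a =>
      rw [LinearMap.rTensor_tmul, contract_tmul, map_smul, op_apply]
      induction M.coact w with
      | zero => simp
      | add x y hx hy => simp only [TensorProduct.add_tmul, map_add, hx, hy, smul_add]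
      | tmul u c => simp [mul_smul, smul_comm (φ c)]
  have h2 : ∀ t : V ⊗[k] A, contract V (LinearMap.mul' k k ∘ₗ TensorProduct.map φ ψ)
      ((Coalgebra.comul (R := k) (A := A)).lTensor V t) =
      contract V (LinearMap.mul' k k ∘ₗ TensorProduct.map φ ψ ∘ₗ Coalgebra.comul) t := by
    intro t
    induction t with
    | zero => simp
    | add a b ha hb => simp only [map_add, ha, hb]
    | tmul w a => simp
  have h3 := h2 (M.coact v)
  rw [← h, h1] at h3
  exact h3

-- Local finiteness: the coefficients of the coaction at a nonzero v span a submodule. It contains v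
-- by the counit axiom, and only finitely many coefficients are nonzero.
variable {M} in
theorem IsSimple.finiteDimensional (hM : M.IsSimple) : FiniteDimensional k V := by
  let b := Module.Basis.ofVectorSpace k A
  obtain ⟨-, -, hlt, hmin⟩ := hM
  obtain ⟨v, -, hv⟩ := SetLike.exists_of_lt hlt
  let W := Submodule.span k (Set.range fun i => M.op (b.coord i) v)
  have hvW : v ∈ W := by
    have := op_mem_span b M Coalgebra.counit v
    rwa [op_counit] at this
  have hW : M.IsSub W := by
    rw [isSub_iff_op b]
    intro j w hw
    induction hw using Submodule.span_induction with
    | mem w hw =>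
      obtain ⟨i, rfl⟩ := hw
      change M.op _ (M.op _ v) ∈ W
      rw [op_op]
      exact op_mem_span b M _ v
    | zero => simp
    | add x y _ _ hx hy => rw [map_add]; exact add_mem hx hy
    | smul c x _ hx => rw [map_smul]; exact Submodule.smul_mem _ _ hx
  have hWtop : W = ⊤ := by
    rcases hmin W hW bot_le le_top with h | h
    · rw [h] at hvW
      exact absurd hvW hv
    · exact h
  obtain ⟨s, hs, -⟩ := exists_eq_sum_contract b (M.coact v)
  have hfin : (Set.range fun i => M.op (b.coord i) v).Finite := by
    refine Set.Finite.subset ((s.finite_toSet.image fun i => M.op (b.coord i) v).insert 0) ?_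
    rintro _ ⟨i, rfl⟩
    by_cases hi : i ∈ s
    · exact Or.inr ⟨i, hi, rfl⟩
    · exact Or.inl (hs i hi)
  exact ⟨⟨hfin.toFinset, by rw [hfin.coe_toFinset]; exact hWtop⟩⟩

/-- This is why operators are indexed by a basis of A: the same basis serves over E, so the
operators on V_E are those of V extended linearly. -/
theorem op_baseChange (E : Type*) [Field E] [Algebra k E] (i : ι) :
    (M.baseChange E).op ((Algebra.TensorProduct.basis E b).coord i) =
      (M.op (b.coord i)).baseChange E := by
  refine TensorProduct.AlgebraTensorModule.ext fun e v => ?_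
  rw [op_apply, LinearMap.baseChange_tmul, op_apply]
  change contract _ _ (TensorProduct.AlgebraTensorModule.distribBaseChange k E V A
    (e ⊗ₜ M.coact v)) = _
  induction M.coact v with
  | zero => simp
  | add x y hx hy => simp only [TensorProduct.tmul_add, map_add, hx, hy]
  | tmul w a =>
    rw [TensorProduct.AlgebraTensorModule.distribBaseChange_tmul, contract_tmul, contract_tmul]
    simp [TensorProduct.smul_tmul']

end Coefficients

end GModule

/-! ### An algebra acting simply, its centraliser, and their common centre. -/

section Bicommutant

variable {k : Type*} {V : Type v} [Field k] [AddCommGroup V] [Module k V]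
  {B D : Subalgebra k (Module.End k V)} [IsSimpleModule B V]

/-- The double centraliser property, from Jacobson density applied to a finite basis of V. -/
theorem mem_of_commute_centralizer [FiniteDimensional k V]
    (hD : ∀ f, f ∈ D ↔ ∀ b ∈ B, f * b = b * f)
    {f : Module.End k V} (hf : ∀ d ∈ D, f * d = d * f) : f ∈ B := by
  classical
  have hend : ∀ g : Module.End B V, ∀ v, f (g v) = g (f v) := by
    intro g v
    have hg : (g.restrictScalars k : Module.End k V) ∈ D := by
      rw [hD]
      intro b hb
      ext v
      exact g.map_smul (⟨b, hb⟩ : B) v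
    exact LinearMap.congr_fun (hf _ hg) v
  let F : Module.End (Module.End B V) V :=
    { toFun := f
      map_add' := f.map_add
      map_smul' := hend }
  obtain ⟨r, hr⟩ := jacobson_density (R := B) (M := V) F (Finset.univ.image (Module.finBasis k V))
  have : f = r.1 := by
    refine (Module.finBasis k V).ext fun i => ?_
    exact hr _ (Finset.mem_image_of_mem _ (Finset.mem_univ i))
  rw [this]
  exact r.2

-- V is faithful and simple, so the radical vanishes. Moreover each minimal left ideal acts
-- nontrivially on some vector and is therefore isomorphic to V, so `B` is isotypic.
variable (B) in
theorem isSimpleRing_of_isSimpleModule [FiniteDimensional k V] : IsSimpleRing B := by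
  have : IsArtinianRing B := IsArtinianRing.of_finite k B
  have hfaith : ∀ b : B, (∀ v : V, b • v = 0) → b = 0 := fun b h =>
    Subtype.ext (LinearMap.ext h)
  have hss : IsSemisimpleRing B := by
    rw [IsArtinianRing.isSemisimpleRing_iff_jacobson, eq_bot_iff]
    intro b hb
    exact hfaith b (Module.mem_annihilator.1 (IsSemisimpleModule.jacobson_le_annihilator B V hb))
  have hiso : IsIsotypicOfType B B V := by
    intro m hm
    have := IsSimpleModule.nontrivial B m
    obtain ⟨a, ha⟩ := exists_ne (0 : m)
    obtain ⟨v, hv⟩ : ∃ v : V, (a : B) • v ≠ 0 := by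
      by_contra! h
      exact ha (Subtype.ext (hfaith a h))
    let g : m →ₗ[B] V := LinearMap.toSpanSingleton B V v ∘ₗ m.subtype
    have hg : g ≠ 0 := fun h => hv (LinearMap.congr_fun h a)
    exact ⟨LinearEquiv.ofBijective g (LinearMap.bijective_of_ne_zero hg)⟩
  have : Nontrivial V := IsSimpleModule.nontrivial B V
  have : Nontrivial B := inferInstance
  exact (isSimpleRing_isArtinianRing_iff.2 ⟨hss, hiso.isIsotypic, this⟩).1

theorem isSimpleRing_of_centralizer (hD : ∀ f, f ∈ D ↔ ∀ b ∈ B, f * b = b * f) :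
    IsSimpleRing D := by
  have : Nontrivial V := IsSimpleModule.nontrivial B V
  have hu : ∀ d : D, IsUnit d ∨ d = 0 := by
    intro d
    by_cases hd : d = 0
    · exact Or.inr hd
    left
    let g : V →ₗ[B] V :=
      { toFun := d.1
        map_add' := d.1.map_add
        map_smul' := fun b v => LinearMap.congr_fun ((hD _).1 d.2 b b.2) v }
    have hg : g ≠ 0 := fun h => hd (Subtype.ext (LinearMap.ext fun v => LinearMap.congr_fun h v))
    let e := LinearEquiv.ofBijective g (LinearMap.bijective_of_ne_zero hg)
    have he : (e.symm.toLinearMap.restrictScalars k : Module.End k V) ∈ D := by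
      rw [hD]
      intro b hb
      ext v
      exact e.symm.map_smul (⟨b, hb⟩ : B) v
    refine ⟨⟨d, ⟨_, he⟩, ?_, ?_⟩, rfl⟩
    · ext v
      exact e.apply_symm_apply v
    · ext v
      exact e.symm_apply_apply v
  let := DivisionRing.ofIsUnitOrEqZero hu
  infer_instance

/-- The centre of `B` commutes with `B`, so it lies in D; a central element of D lies in `B` by the
double centraliser property. -/
theorem exists_common_center [FiniteDimensional k V]
    (hD : ∀ f, f ∈ D ↔ ∀ b ∈ B, f * b = b * f) :
    ∃ (Z : Type v) (_ : Field Z) (_ : Algebra k Z) (_ : Module Z V) (_ : Algebra Z B)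
      (_ : Algebra Z D) (_ : IsScalarTower k Z V) (_ : IsScalarTower k Z B)
      (_ : IsScalarTower k Z D), FiniteDimensional k Z ∧ Algebra.IsCentral Z B ∧
      Algebra.IsCentral Z D ∧ ∀ (z : Z) (v : V), (algebraMap Z B z : Module.End k V) v = z • v := by
  have := isSimpleRing_of_isSimpleModule B
  have hfield : IsField (Subalgebra.center k B) := IsSimpleRing.isField_center B
  let Z := Subalgebra.center k B
  have hZD : ∀ z : Z, ((z : B) : Module.End k V) ∈ D := by
    intro z
    rw [hD]
    intro b hb
    exact congrArg Subtype.val (((Subalgebra.mem_center_iff).1 z.2) ⟨b, hb⟩).symm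
  let _ : Field Z := hfield.toField
  let aB : Algebra Z B := RingHom.toAlgebra' (Z.val : Z →+* B) fun z b =>
    (((Subalgebra.mem_center_iff).1 z.2) b).symm
  let φ : Z →+* D :=
    { toFun := fun z => ⟨_, hZD z⟩
      map_one' := rfl
      map_mul' := fun _ _ => rfl
      map_zero' := rfl
      map_add' := fun _ _ => rfl }
  let aD : Algebra Z D := RingHom.toAlgebra' φ fun z d => by
    apply Subtype.ext
    exact ((hD _).1 d.2 _ z.1.2).symm
  refine ⟨Z, inferInstance, inferInstance, inferInstance, aB, aD, ?_, ?_, ?_, ?_, ?_, ?_, ?_⟩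
  · exact ⟨fun c z v => rfl⟩
  · exact IsScalarTower.of_algebraMap_eq fun c => rfl
  · exact IsScalarTower.of_algebraMap_eq fun c => rfl
  · exact FiniteDimensional.of_injective Z.val.toLinearMap Subtype.val_injective
  · refine ⟨fun b hb => ?_⟩
    have hb' : b ∈ Z := Subalgebra.mem_center_iff.2 (Subalgebra.mem_center_iff.1 hb)
    exact ⟨⟨b, hb'⟩, rfl⟩
  · refine ⟨fun d hd => ?_⟩
    have hdB : (d : Module.End k V) ∈ B := mem_of_commute_centralizer hD fun d' hd' =>
      (congrArg Subtype.val (Subalgebra.mem_center_iff.1 hd ⟨d', hd'⟩)).symm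
    have hdZ : (⟨d, hdB⟩ : B) ∈ Z := Subalgebra.mem_center_iff.2 fun b => by
      apply Subtype.ext
      exact ((hD _).1 d.2 b b.2).symm
    exact ⟨⟨_, hdZ⟩, rfl⟩
  · intro z v
    rfl

end Bicommutant

/-! ### Powers of ideals extended from the central subring E ⊗ Z. -/

section MapPow

variable {k Z : Type*} (E : Type*) [Field k] [Field Z] [Algebra k Z] [Field E] [Algebra k E]
  {C : Type*} [Ring C] [Algebra k C] [Algebra Z C] [IsScalarTower k Z C]

theorem map_tensorAlgebraMap_mul_le (I I' : Ideal (E ⊗[k] Z)) :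
    I.map (tensorAlgebraMap k Z E C) * I'.map (tensorAlgebraMap k Z E C) ≤
      (I * I').map (tensorAlgebraMap k Z E C) := by
  rw [Ideal.mul_le]
  intro x hx y hy
  refine Submodule.span_induction (p := fun x _ => x * y ∈ _) ?_ ?_ ?_ ?_ hx
  · rintro _ ⟨r, hr, rfl⟩
    refine Submodule.span_induction
      (p := fun y _ => tensorAlgebraMap k Z E C r * y ∈ _) ?_ ?_ ?_ ?_ hy
    · rintro _ ⟨s, hs, rfl⟩
      change tensorAlgebraMap k Z E C r * tensorAlgebraMap k Z E C s ∈ _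
      rw [← map_mul]
      exact Ideal.mem_map_of_mem _ (Ideal.mul_mem_mul hr hs)
    · rw [mul_zero]
      exact zero_mem _
    · intro a b _ _ ha hb
      rw [mul_add]
      exact add_mem ha hb
    · intro a b _ hb
      rw [smul_eq_mul, ← mul_assoc, (tensorAlgebraMap_commute E r a).eq, mul_assoc]
      exact Ideal.mul_mem_left _ _ hb
  · rw [zero_mul]
    exact zero_mem _
  · intro a b _ _ ha hb
    rw [add_mul]
    exact add_mem ha hb
  · intro a b _ hb
    rw [smul_eq_mul, mul_assoc]
    exact Ideal.mul_mem_left _ _ hb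

theorem map_tensorAlgebraMap_pow_le (I : Ideal (E ⊗[k] Z)) (i : ℕ) :
    I.map (tensorAlgebraMap k Z E C) ^ i ≤ (I ^ i).map (tensorAlgebraMap k Z E C) := by
  induction i with
  | zero =>
    rw [pow_zero, Ideal.one_eq_top, Ideal.map_top]
    exact le_top
  | succ i ih =>
    rw [Submodule.pow_succ, pow_succ]
    exact (Ideal.mul_mono_left ih).trans (map_tensorAlgebraMap_mul_le E _ _)

theorem tensorAlgebraMap_mem_pow {I : Ideal (E ⊗[k] Z)} {i : ℕ} {s : E ⊗[k] Z} (hs : s ∈ I ^ i) :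
    tensorAlgebraMap k Z E C s ∈ I.map (tensorAlgebraMap k Z E C) ^ i := by
  induction i generalizing s with
  | zero =>
    rw [Submodule.pow_zero, Ideal.one_eq_top]
    trivial
  | succ i ih =>
    rw [pow_succ] at hs
    induction hs using Submodule.mul_induction_on' with
    | mem_mul_mem x hx y hy =>
      rw [map_mul]
      exact Ideal.mul_mem_mul (ih hx) (Ideal.mem_map_of_mem _ hy)
    | add x _ y _ hx hy =>
      rw [map_add]
      exact add_mem hx hy

end MapPow

/-! ### Rigidity of V_E from the nilradical of E ⊗ Z. -/

namespace GModule

variable {k A V : Type*} [Field k] [CommRing A] [HopfAlgebra k A] [AddCommGroup V] [Module k V]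
  {M : GModule k A V} {ι : Type*} (b : Module.Basis ι k A)

variable (M) in
/-- The algebra of operators on `V` generated by the coefficients of the coaction. -/
noncomputable def opAlgebra : Subalgebra k (Module.End k V) :=
  Algebra.adjoin k (Set.range fun i => M.op (b.coord i))

theorem isSub_iff_opAlgebra {W : Submodule k V} :
    M.IsSub W ↔ ∀ f ∈ M.opAlgebra b, ∀ w ∈ W, f w ∈ W := by
  rw [isSub_iff_op b]
  refine ⟨fun h f hf => ?_, fun h i => h _ (Algebra.subset_adjoin ⟨i, rfl⟩)⟩
  induction hf using Algebra.adjoin_induction with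
  | mem f hf =>
    obtain ⟨i, rfl⟩ := hf
    exact h i
  | algebraMap c => exact fun w hw => W.smul_mem c hw
  | add f g _ _ hf hg => exact fun w hw => W.add_mem (hf w hw) (hg w hw)
  | mul f g _ _ hf hg => exact fun w hw => hf _ (hg w hw)

theorem mem_endAlgebra_iff_opAlgebra {f : Module.End k V} :
    f ∈ M.endAlgebra ↔ ∀ g ∈ M.opAlgebra b, f * g = g * f := by
  rw [mem_endAlgebra_iff_op b]
  refine ⟨fun h g hg => ?_, fun h i => h _ (Algebra.subset_adjoin ⟨i, rfl⟩)⟩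
  induction hg using Algebra.adjoin_induction with
  | mem g hg =>
    obtain ⟨i, rfl⟩ := hg
    exact h i
  | algebraMap c => exact (Algebra.commutes c f).symm
  | add g g' _ _ hg hg' => rw [mul_add, add_mul, hg, hg']
  | mul g g' _ _ hg hg' => rw [← mul_assoc, hg, mul_assoc, hg', mul_assoc]

theorem IsSimple.isSimpleModule_opAlgebra (hM : M.IsSimple) : IsSimpleModule (M.opAlgebra b) V := by
  obtain ⟨-, -, hlt, hmin⟩ := hM
  rw [isSimpleModule_iff]
  have hres : ∀ P : Submodule (M.opAlgebra b) V,
      P.restrictScalars k = ⊥ ∨ P.restrictScalars k = ⊤ := fun P =>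
    hmin _ ((isSub_iff_opAlgebra b).2 fun f hf w hw =>
      P.smul_mem (⟨f, hf⟩ : M.opAlgebra b) hw) bot_le le_top
  refine { exists_pair_ne := ⟨⊥, ⊤, fun h => hlt.ne ?_⟩, eq_bot_or_eq_top := fun P => ?_ }
  · exact congrArg (Submodule.restrictScalars k) h
  · refine (hres P).imp (fun h => ?_) fun h => ?_
    · exact Submodule.restrictScalars_injective k _ _ h
    · exact Submodule.restrictScalars_injective k _ _ h

section BaseChange

variable (E : Type*) [Field E] [Algebra k E]

theorem isSub_baseChange_iff_op {W : Submodule E (E ⊗[k] V)} :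
    (M.baseChange E).IsSub W ↔ ∀ i, ∀ w ∈ W, (M.op (b.coord i)).baseChange E w ∈ W := by
  rw [isSub_iff_op (Algebra.TensorProduct.basis E b)]
  simp only [op_baseChange]

/-- The two base changes are comodules over different, merely isomorphic, Hopf algebras. Comparing
submodule lattices suffices and avoids identifying them. -/
theorem isRigid_baseChange_baseChange {F : Type*} [Field F] [Algebra k F] [Algebra F E]
    [IsScalarTower k F E] (h : (M.baseChange E).IsRigid) :
    ((M.baseChange F).baseChange E).IsRigid := by
  let b := Module.Basis.ofVectorSpace k A
  let e := (TensorProduct.AlgebraTensorModule.cancelBaseChange k F E E V).symm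
  refine IsRigid.of_orderIso (Submodule.orderIsoMapComap e) (fun W => ?_) h
  rw [isSub_baseChange_iff_op b, isSub_baseChange_iff_op (Algebra.TensorProduct.basis F b)]
  have he : ∀ i x, ((M.baseChange F).op ((Algebra.TensorProduct.basis F b).coord i)).baseChange E
      (e x) = e ((M.op (b.coord i)).baseChange E x) := by
    intro i x
    rw [op_baseChange]
    induction x with
    | zero => simp
    | add x y hx hy => simp only [map_add, hx, hy]
    | tmul c v => simp [e]
  constructor
  · rintro h i _ ⟨w, hw, rfl⟩
    exact ⟨_, h i w hw, (he i w).symm⟩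
  · intro h i w hw
    obtain ⟨w', hw', h'⟩ := h i (e w) ⟨w, hw, rfl⟩
    have := e.injective (h'.trans (he i w))
    rwa [← this]

variable (V) in
/-- The action of `E ⊗ B` on `E ⊗ V` for an algebra `B` of operators on `V`. -/
noncomputable def operatorAction (B : Subalgebra k (Module.End k V)) :
    E ⊗[k] B →ₐ[E] Module.End E (E ⊗[k] V) :=
  Algebra.TensorProduct.lift (Algebra.ofId E _) ((Module.End.baseChangeHom k E V).comp B.val)
    fun e _ => show Commute (Algebra.ofId E _ e) _ from Algebra.commutes e _

theorem operatorAction_tmul (B : Subalgebra k (Module.End k V)) (e : E) (f : B) (x : E ⊗[k] V) :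
    operatorAction V E B (e ⊗ₜ f) x = e • (f : Module.End k V).baseChange E x := by
  rw [operatorAction, Algebra.TensorProduct.lift_tmul]
  rfl

theorem isRigid_baseChange {Z : Type*} [Field Z] [Algebra k Z] [Module Z V] [IsScalarTower k Z V]
    [FiniteDimensional k Z] [FiniteDimensional k V] [Algebra Z (M.opAlgebra b)]
    [IsScalarTower k Z (M.opAlgebra b)] [Algebra.IsCentral Z (M.opAlgebra b)]
    [IsSimpleRing (M.opAlgebra b)]
    (hZ : ∀ (z : Z) (v : V), (algebraMap Z (M.opAlgebra b) z : Module.End k V) v = z • v)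
    (hE : HasRigidNilradical (E ⊗[k] Z)) : (M.baseChange E).IsRigid := by
  let B := M.opAlgebra b
  have : FiniteDimensional Z B := FiniteDimensional.right k Z B
  have : FiniteDimensional Z V := FiniteDimensional.right k Z V
  have := isArtinianRing_tensorProduct k Z E B
  let _ : Module (E ⊗[k] B) (E ⊗[k] V) := Module.compHom _ (operatorAction V E B).toRingHom
  have hsmul : ∀ (s : E ⊗[k] B) (x : E ⊗[k] V), s • x = operatorAction V E B s x :=
    fun _ _ => rfl
  have : IsScalarTower E (E ⊗[k] B) (E ⊗[k] V) := ⟨fun e s x => by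
    rw [hsmul, hsmul, map_smul, LinearMap.smul_apply]⟩
  have : Module.Finite (E ⊗[k] B) (E ⊗[k] V) :=
    Module.Finite.of_restrictScalars_finite E (E ⊗[k] B) (E ⊗[k] V)
  have hsub : ∀ W, (M.baseChange E).IsSub W ↔
      ∃ W' : Submodule (E ⊗[k] B) (E ⊗[k] V), W'.restrictScalars E = W := by
    intro W
    rw [isSub_baseChange_iff_op b]
    constructor
    · intro h
      have hB : ∀ f ∈ B, ∀ w ∈ W, (f : Module.End k V).baseChange E w ∈ W := by
        intro f hf
        induction hf using Algebra.adjoin_induction with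
        | mem f hf =>
          obtain ⟨i, rfl⟩ := hf
          exact h i
        | algebraMap c =>
          intro w hw
          rw [Algebra.algebraMap_eq_smul_one, LinearMap.baseChange_smul, Module.End.one_eq_id,
            LinearMap.baseChange_id]
          exact W.smul_of_tower_mem c hw
        | add f g _ _ hf hg =>
          intro w hw
          rw [LinearMap.baseChange_add]
          exact W.add_mem (hf w hw) (hg w hw)
        | mul f g _ _ hf hg =>
          intro w hw
          rw [Module.End.mul_eq_comp, LinearMap.baseChange_comp]
          exact hf _ (hg w hw)
      refine ⟨{ W with smul_mem' := fun s w hw => ?_ }, rfl⟩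
      change s • w ∈ W
      rw [hsmul]
      induction s with
      | zero => simp
      | add s t hs ht => rw [map_add]; exact W.add_mem hs ht
      | tmul e f =>
        rw [operatorAction_tmul]
        exact W.smul_mem _ (hB f f.2 w hw)
    · rintro ⟨W', rfl⟩ i w hw
      have := W'.smul_mem ((1 : E) ⊗ₜ[k] (⟨_, Algebra.subset_adjoin ⟨i, rfl⟩⟩ : B)) hw
      rwa [hsmul, operatorAction_tmul, one_smul] at this
  have hact : ∀ (r : E ⊗[k] Z) (x : E ⊗[k] V),
      tensorAlgebraMap k Z E B r • x = tensorAction E k Z V r x := by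
    intro r x
    rw [hsmul]
    induction r with
    | zero => simp
    | add r s hr hs => simp only [map_add, LinearMap.add_apply, hr, hs]
    | tmul e z =>
      rw [tensorAlgebraMap_tmul, operatorAction_tmul]
      induction x with
      | zero => simp
      | add x y hx hy => simp only [map_add, smul_add, hx, hy]
      | tmul e' v =>
        rw [LinearMap.baseChange_tmul, hZ, tensorAction_tmul, TensorProduct.smul_tmul', smul_eq_mul]
  obtain ⟨ℓ, hℓ, hann⟩ := hE
  have hJ := jacobson_tensorProduct_eq_map k Z E B
  refine isRigid_of_torsion_le (S := E ⊗[k] B) hsub (ℓ := ℓ) ?_ fun i hi x hx => ?_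
  · rw [hJ, eq_bot_iff]
    refine (map_tensorAlgebraMap_pow_le E _ ℓ).trans ?_
    rw [hℓ, Ideal.map_bot]
  -- V is free over Z, so the coordinates of x in E ⊗ Z are killed by n^i. They lie in n^(ℓ-i),
  -- which puts x in J^(ℓ-i) V_E.
  · rw [eq_sum_tensorAction E (Module.finBasis Z V) x]
    refine sum_mem fun j _ => ?_
    rw [← hact]
    refine Submodule.smul_mem_smul ?_ trivial
    rw [hJ]
    refine tensorAlgebraMap_mem_pow E (hann i hi _ fun s hs => ?_)
    rw [← coordTensor_tensorAction, ← hact, hx _ (hJ ▸ tensorAlgebraMap_mem_pow E hs), map_zero]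

end BaseChange

end GModule

/-! ### Fields of definition. -/

theorem mem_perfectClosure_of_forall_algEquiv {k K : Type*} [Field k] [Field K] [Algebra k K]
    [IsAlgClosure k K] {x : K} (h : ∀ σ : K ≃ₐ[k] K, σ x = x) : x ∈ perfectClosure k K := by
  classical
  have := IsAlgClosure.isAlgClosed (R := k) (K := K)
  have := IsAlgClosure.normal k K
  have hx : IsIntegral k x := Algebra.IsIntegral.isIntegral x
  -- The roots of the minimal polynomial are the images of x under automorphisms, so x is its only
  -- root.
  rw [mem_perfectClosure_iff_natSepDegree_eq_one, Polynomial.natSepDegree_eq_of_isAlgClosed K,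
    Finset.card_eq_one]
  refine ⟨x, Finset.eq_singleton_iff_unique_mem.2 ⟨?_, fun y hy => ?_⟩⟩
  · simp [minpoly.ne_zero hx]
  · rw [Multiset.mem_toFinset, ← isConjRoot_iff_mem_minpoly_aroots hx,
      isConjRoot_iff_exists_algEquiv] at hy
    obtain ⟨σ, hσ⟩ := hy
    rw [← hσ]
    exact σ.injective (by rw [hσ, h])

/-- For a subspace `W` of `K ⊗ U`, a basis of `U` and a subset of it which gives a basis of the
quotient by `W`: the coefficients of the elements of the basis of `U` modulo `W`. -/
theorem exists_coefficients {k K U ι : Type*} [Field k] [Field K] [Algebra k K] [AddCommGroup U]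
    [Module k U] [Fintype ι] (e : Module.Basis ι k U) (W : Submodule K (K ⊗[k] U)) :
    ∃ (κ : Type) (_ : Fintype κ) (a : κ → ι) (c : ι → κ → K),
      (∀ i, 1 ⊗ₜ e i - ∑ j, c i j ⊗ₜ e (a j) ∈ W) ∧
      ∀ d : κ → K, ∑ j, d j ⊗ₜ e (a j) ∈ W → d = 0 := by
  let q : ι → (K ⊗[k] U) ⧸ W := fun i => W.mkQ (1 ⊗ₜ e i)
  obtain ⟨κ, a, ha, hspan, hli⟩ := exists_linearIndependent' K q
  have := Finite.of_injective a ha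
  obtain ⟨n, ⟨g⟩⟩ := Finite.exists_equiv_fin κ
  have htop : ∀ t : K ⊗[k] U, W.mkQ t ∈ Submodule.span K (Set.range (q ∘ a)) := by
    intro t
    rw [hspan, ← (e.baseChange K).sum_repr t, map_sum]
    refine sum_mem fun i _ => ?_
    rw [map_smul, Module.Basis.baseChange_apply]
    exact Submodule.smul_mem _ _ (Submodule.subset_span ⟨i, rfl⟩)
  have hli' : LinearIndependent K ((q ∘ a) ∘ g.symm) := hli.comp _ g.symm.injective
  have hr : Set.range ((q ∘ a) ∘ g.symm) = Set.range (q ∘ a) := g.symm.surjective.range_comp _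
  have hmk : ∀ d : Fin n → K, W.mkQ (∑ j, d j ⊗ₜ e (a (g.symm j))) =
      ∑ j, d j • ((q ∘ a) ∘ g.symm) j := by
    intro d
    rw [map_sum]
    refine Finset.sum_congr rfl fun j _ => ?_
    rw [Function.comp_apply, Function.comp_apply, ← map_smul, TensorProduct.smul_tmul',
      smul_eq_mul, mul_one]
  have hc : ∀ i, ∃ d : Fin n → K, ∑ j, d j • ((q ∘ a) ∘ g.symm) j = q i := fun i => by
    rw [← Submodule.mem_span_range_iff_exists_fun, hr]
    exact htop _
  choose c hc using hc
  refine ⟨Fin n, inferInstance, a ∘ g.symm, c, fun i => ?_, fun d hd => ?_⟩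
  · rw [← Submodule.Quotient.mk_eq_zero, ← Submodule.mkQ_apply, map_sub, sub_eq_zero]
    exact (hc i).symm.trans (hmk _).symm
  · rw [← Submodule.Quotient.mk_eq_zero, ← Submodule.mkQ_apply] at hd
    have := (hmk d).symm.trans hd
    exact funext (Fintype.linearIndependent_iff.1 hli' d this)

section FieldOfDefinition

variable {k K D : Type*} [Field k] [Field K] [Algebra k K] [Ring D] [Algebra k D]

theorem IsFieldOfDefinition.exists_eq_map {J : Ideal (K ⊗[k] D)} {F : IntermediateField k K}
    (h : IsFieldOfDefinition J F) :
    ∃ N : Ideal (F ⊗[k] D), J = N.map (extendScalarsHom k K D) := by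
  obtain ⟨N, hN⟩ := h
  refine ⟨N, le_antisymm ?_ ?_⟩
  · intro x hx
    have hx' : x ∈ J.restrictScalars K := hx
    rw [← hN] at hx'
    have : Submodule.span K ((Algebra.TensorProduct.map F.val (AlgHom.id k D) :
        F ⊗[k] D → K ⊗[k] D) '' (N : Set (F ⊗[k] D))) ≤
        (N.map (extendScalarsHom k K D)).restrictScalars K := by
      rw [Submodule.span_le]
      rintro _ ⟨n, hn, rfl⟩
      exact Ideal.mem_map_of_mem (extendScalarsHom k K D) hn
    exact this hx'
  · rw [Ideal.map_le_iff_le_comap]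
    intro n hn
    have : (Algebra.TensorProduct.map F.val (AlgHom.id k D) : F ⊗[k] D → K ⊗[k] D) n ∈
      J.restrictScalars K := by
      rw [← hN]
      exact Submodule.subset_span ⟨n, hn, rfl⟩
    exact this

/-- A left ideal of `K ⊗ D` has a smallest field of definition, generated by finitely many
elements which are fixed by the automorphisms of `K` that stabilize the ideal. -/
theorem exists_isMinimalFieldOfDefinition [FiniteDimensional k D] (J : Ideal (K ⊗[k] D)) :
    ∃ S : Set K, S.Finite ∧ IsMinimalFieldOfDefinition J (IntermediateField.adjoin k S) ∧
      ∀ σ : K ≃ₐ[k] K, (∀ x ∈ J, Algebra.TensorProduct.map (σ : K →ₐ[k] K) (AlgHom.id k D) x ∈ J) →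
        ∀ x ∈ S, σ x = x := by
  let e := Module.finBasis k D
  obtain ⟨κ, _, a, c, hc, huniq⟩ := exists_coefficients e (J.restrictScalars K)
  have hc' : ∀ i, 1 ⊗ₜ e i - ∑ j, c i j ⊗ₜ e (a j) ∈ J := hc
  have heq : ∀ i (d : κ → K), 1 ⊗ₜ e i - ∑ j, d j ⊗ₜ e (a j) ∈ J → ∀ j, d j = c i j := by
    intro i d hd j
    have h1 := sub_mem (hc' i) hd
    have h2 : ∑ j, (d j - c i j) ⊗ₜ[k] e (a j) ∈ J.restrictScalars K := by
      simpa [TensorProduct.sub_tmul] using h1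
    exact sub_eq_zero.1 (congrFun (huniq _ h2) j)
  refine ⟨Set.range fun p : _ × κ => c p.1 p.2, Set.finite_range _, ⟨?_, ?_⟩, ?_⟩
  · set F := IntermediateField.adjoin k (Set.range fun p : _ × κ => c p.1 p.2)
    have hF : ∀ i j, c i j ∈ F := fun i j =>
      IntermediateField.subset_adjoin k _ ⟨(i, j), rfl⟩
    refine ⟨J.comap (Algebra.TensorProduct.map F.val (AlgHom.id k D)), le_antisymm ?_ ?_⟩
    · rw [Submodule.span_le]
      rintro _ ⟨n, hn, rfl⟩
      exact hn
    · intro x hx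
      have hxe := ((e.baseChange K).sum_repr x).symm
      set r := (e.baseChange K).repr x
      simp only [Module.Basis.baseChange_apply] at hxe
      -- Reduce x by the relations with coefficients in F. The remainder lies in J and involves only
      -- vectors independent modulo J, so it vanishes.
      have hsum : x = ∑ i, r i • ((1 : K) ⊗ₜ e i - ∑ j, c i j ⊗ₜ e (a j)) +
          ∑ j, (∑ i, r i * c i j) ⊗ₜ e (a j) := by
        simp only [TensorProduct.sum_tmul]
        rw [Finset.sum_comm, ← Finset.sum_add_distrib]
        conv_lhs => rw [hxe]
        refine Finset.sum_congr rfl fun i _ => ?_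
        rw [smul_sub, Finset.smul_sum]
        simp [TensorProduct.smul_tmul']
      have hd : ∑ j, (∑ i, r i * c i j) ⊗ₜ[k] e (a j) ∈ J.restrictScalars K := by
        rw [eq_sub_of_add_eq' hsum.symm]
        exact sub_mem hx (sum_mem fun i _ => Submodule.smul_mem _ _ (hc i))
      have hd0 := huniq _ hd
      rw [hsum]
      have : ∑ j, (∑ i, r i * c i j) ⊗ₜ[k] e (a j) = (0 : K ⊗[k] D) :=
        Finset.sum_eq_zero fun j _ => by
          rw [show (∑ i, r i * c i j) = 0 from congrFun hd0 j, TensorProduct.zero_tmul]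
      rw [this, add_zero]
      refine sum_mem fun i _ => Submodule.smul_mem _ _ (Submodule.subset_span
        ⟨1 ⊗ₜ e i - ∑ j, (⟨c i j, hF i j⟩ : F) ⊗ₜ e (a j), ?_, ?_⟩)
      · rw [SetLike.mem_coe, Ideal.mem_comap]
        simpa using hc' i
      · simp
  · intro F hF
    obtain ⟨N, hN⟩ := IsFieldOfDefinition.exists_eq_map hF
    rw [IntermediateField.adjoin_le_iff]
    rintro _ ⟨⟨i, j⟩, rfl⟩
    -- An F-linear retraction of K onto F turns each relation into one with coefficients in F;
    -- uniqueness identifies the two.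
    obtain ⟨ρ, hρ⟩ := exists_functional_one F K
    have h1 := hc' i
    rw [hN, mem_map_extendScalarsHom_iff] at h1
    have h2 := Ideal.mem_map_of_mem (extendScalarsHom k K D) (h1 ρ)
    rw [← hN] at h2
    have h3 := heq i (fun j => algebraMap F K (ρ (c i j))) (by simpa [hρ] using h2) j
    change c i j ∈ F
    rw [← h3]
    exact (ρ (c i j)).2
  · rintro σ hσ _ ⟨⟨i, j⟩, rfl⟩
    exact heq i (fun j => σ (c i j)) (by simpa using hσ _ (hc' i)) j

/-- Functionals K → F preserve the radical of K ⊗ D when it is defined over F. A nilpotent of K ⊗ Z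
lies in this radical, so its coordinates in F ⊗ Z do too, and are nilpotent. -/
theorem nilradicalExtends_of_isFieldOfDefinition {Z : Type*} [Field Z] [Algebra k Z] [Algebra Z D]
    [IsScalarTower k Z D] [IsSimpleRing D] [Algebra.IsCentral Z D] [FiniteDimensional Z D]
    [FiniteDimensional k Z] {F : IntermediateField k K}
    (h : IsFieldOfDefinition (Ring.jacobson (K ⊗[k] D)) F) :
    NilradicalExtends (k := k) F K Z := by
  refine le_antisymm (fun n hn => ?_) map_nilradical_le
  obtain ⟨N, hN⟩ := h.exists_eq_map
  have hmem : tensorAlgebraMap k Z K D n ∈ Ring.jacobson (K ⊗[k] D) := by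
    rw [jacobson_tensorProduct_eq_map k Z K D]
    exact Ideal.mem_map_of_mem _ hn
  rw [hN, mem_map_extendScalarsHom_iff] at hmem
  rw [mem_map_extendScalarsHom_iff]
  intro ρ
  have h1 := Ideal.mem_map_of_mem (extendScalarsHom k K D) (hmem ρ)
  rw [← hN] at h1
  have h2 : extendScalarsHom k K D (functionalTensor k D ρ (tensorAlgebraMap k Z K D n)) =
      tensorAlgebraMap k Z K D (extendScalarsHom k K Z (functionalTensor k Z ρ n)) := by
    clear hn hmem h1
    induction n with
    | zero => simp
    | add x y hx hy => simp only [map_add, hx, hy]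
    | tmul a z => simp
  rw [h2] at h1
  have := isArtinianRing_tensorProduct k Z K D
  obtain ⟨m, hm⟩ := IsSemiprimaryRing.isNilpotent (R := K ⊗[k] D)
  have h3 := Ideal.pow_mem_pow h1 m
  rw [hm, ← map_pow, ← map_pow] at h3
  refine mem_nilradical.2 ⟨m, extendScalarsHom_injective (Ω := K)
    (tensorAlgebraMap_injective (C := D) K ?_)⟩
  rw [map_zero, map_zero]
  exact h3

end FieldOfDefinition

/-! ### The main theorem. -/

theorem theorem1 {k : Type u} {A : Type v} {V : Type w} [Field k] [CommRing A]
    [HopfAlgebra k A] [Algebra.Smooth k A] [AddCommGroup V] [Module k V]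
    (M : GModule k A V) (hM : M.IsSimple) :
    ∃ kV : IntermediateField k (AlgebraicClosure k),
      IsMinimalFieldOfDefinition
        (Ring.jacobson (AlgebraicClosure k ⊗[k] M.endAlgebra)) kV ∧
      FiniteDimensional k kV ∧
      IsPurelyInseparable k kV ∧
      GModule.IsAbsolutelyRigid.{x} (M.baseChange kV) ∧
      M.IsGeometricallyRigid := by
  have : FiniteDimensional k V := hM.finiteDimensional
  let b := Module.Basis.ofVectorSpace k A
  have : IsSimpleModule (M.opAlgebra b) V := GModule.IsSimple.isSimpleModule_opAlgebra b hM
  have hD := fun f => M.mem_endAlgebra_iff_opAlgebra b (f := f)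
  have hB := isSimpleRing_of_isSimpleModule (M.opAlgebra b)
  have hDs := isSimpleRing_of_centralizer hD
  obtain ⟨Z, _, _, _, _, _, _, _, _, _, _, _, hZ⟩ := exists_common_center hD
  have : FiniteDimensional Z M.endAlgebra := FiniteDimensional.right k Z M.endAlgebra
  have hK : HasRigidNilradical (AlgebraicClosure k ⊗[k] Z) :=
    hasRigidNilradical_tensorProduct (AlgebraicClosure k) Z
  obtain ⟨S, hS, hmin, hfix⟩ := exists_isMinimalFieldOfDefinition
    (Ring.jacobson (AlgebraicClosure k ⊗[k] M.endAlgebra))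
  refine ⟨IntermediateField.adjoin k S, hmin, ?_, ?_, ?_, ?_⟩
  · have := hS.to_subtype
    exact IntermediateField.finiteDimensional_adjoin fun x _ => Algebra.IsIntegral.isIntegral x
  · rw [← le_perfectClosure_iff, IntermediateField.adjoin_le_iff]
    refine fun x hx => mem_perfectClosure_of_forall_algEquiv fun σ => hfix σ ?_ x hx
    -- The ring automorphism induced by σ preserves the Jacobson radical, so σ fixes the
    -- coefficients.
    let Φ := Algebra.TensorProduct.congr σ (AlgEquiv.refl (R := k) (A₁ := M.endAlgebra))
    have : RingHomSurjective Φ.toRingHom := ⟨Φ.surjective⟩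
    exact fun y hy => Ring.le_comap_jacobson Φ.toRingHom hy
  -- The field of definition is read off from D, while rigidity concerns `B`; the common centre Z
  -- links them.
  · have hext := nilradicalExtends_of_isFieldOfDefinition (Z := Z) hmin.1
    have hF := hK.descend hext
    intro E _ _
    let _ : Algebra k E := Algebra.compHom E (algebraMap k (IntermediateField.adjoin k S))
    have : IsScalarTower k (IntermediateField.adjoin k S) E := .of_algebraMap_eq fun _ => rfl
    exact GModule.isRigid_baseChange_baseChange E
      (GModule.isRigid_baseChange b E hZ (hF.ascend (.of_algClosed E hext)))
  · exact GModule.isRigid_baseChange b _ hZ hK
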